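/- Let $n\ge k\ge 2$ and $0\le q\le k$ be integers. Let $C_k$ be the cycle graph with vertices $v_j$ and edges $e_j$, $j\in\mathbb{Z}_k$, where $e_j$ joins $v_j$ to $v_{j+1}$, and let $V$ and $E$ be its sets of vertices and edges. Realize $C_k$ as the circle $\mathbb{R}/k\mathbb{Z}$, with $v_j$ the class of $j$ and $e_j$ the image of $[j,j+1]$. Let $\Omega(k,n,q)$ be the space of all $n$-tuples $(x_1,\dots,x_n)\in(\mathbb{R}/k\mathbb{Z})^n$ such that $|V\cap\{x_1,\dots,x_n\}|\ge q$. Let $\mathcal{C}^{\mathbb{Z}_k,q}$ be the following chain complex of free abelian groups, graded by $\mathbb{Z}$. The group in degree $d$ is freely generated by the $n$-tuples $\sigma=(\sigma_1,\dots,\sigma_n)\in(V\cup E)^n$ with exactly $d$ entries in $E$ and with $|V\cap\{\sigma_1,\dots,\sigma_n\}|\ge q$. The boundary operator is the cubical one, $$\partial\sigma=\sum_{i:\ \sigma_i=e_{j_i}\in E}(-1)^{\rho(\sigma,i)}\Big((\sigma_1,\dots,\sigma_{i-1},v_{j_i+1},\sigma_{i+1},\dots,\sigma_n)-(\sigma_1,\dots,\sigma_{i-1},v_{j_i},\sigma_{i+1},\dots,\sigma_n)\Big),$$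 where $\rho(\sigma,i)=|\{l<i:\sigma_l\in E\}|$. Then $\Omega(k,n,q)$ is a union of closed cells of the product cubical structure on $(\mathbb{R}/k\mathbb{Z})^n$, and $\mathcal{C}^{\mathbb{Z}_k,q}$ is isomorphic to its cubical chain complex (the complex generated by the cells contained in $\Omega(k,n,q)$, with the cubical boundary operator). Moreover, $$H_i(\mathcal{C}^{\mathbb{Z}_k,q})\cong\mathbb{Z}^{\binom{n}{i}}\quad\text{for } 0\le i\le n-q-1,\qquad H_i(\mathcal{C}^{\mathbb{Z}_k,q})=0\quad\text{for } i<0 \text{ and for } i>n-q.$$ -/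

import Mathlib

noncomputable section

namespace AnchoredConf

/-- The generalized anchored configuration space: all `n`-tuples of points of `X` such that at
least `q` of the points of `K` occur among the entries of the tuple. (`K ∩ Set.range x` is always
finite, so `Set.ncard` is its true cardinality.) -/
def gacs {X : Type*} (K : Set X) (n q : ℕ) : Set (Fin n → X) :=
  {x | q ≤ (K ∩ Set.range x).ncard}

/-! ### Vertex-edge tuples on the cycle graph with `k` vertices and `k` edges -/

/-- The vertices (`Sum.inl j`, written `v_j`) and the edges (`Sum.inr j`, written `e_j`) of the
cycle graph; the edge `e_j` joins `v_j` and `v_{j+1}`, with `j + 1` computed in `ZMod k`. -/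
abbrev VE (k : ℕ) : Type := ZMod k ⊕ ZMod k

/-- Vertex-edge `n`-tuples; they index the cells of the `n`-th power of the cycle graph. -/
abbrev VETuple (k n : ℕ) : Type := Fin n → VE k

variable {k n : ℕ}

/-- The vertex support set. -/
def suppV (σ : VETuple k n) : Set (ZMod k) := {j | ∃ i, σ i = Sum.inl j}

/-- The dimension: the number of entries that are edges. -/
def dim (σ : VETuple k n) : ℕ := (Finset.univ.filter fun i => (σ i).isRight = true).card

/-- The number of entries before position `i` that are edges. -/
def rho (σ : VETuple k n) (i : Fin n) : ℕ :=
  (Finset.univ.filter fun l => l < i ∧ (σ l).isRight = true).card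

/-- `τ` is a face of `σ`: every entry of `τ` is the entry of `σ`, or an endpoint of it. -/
def IsFace (τ σ : VETuple k n) : Prop :=
  ∀ i, τ i = σ i ∨ ∃ j, σ i = Sum.inr j ∧ (τ i = Sum.inl j ∨ τ i = Sum.inl (j + 1))

/-- The contribution of position `i` to the cubical boundary: if `σ i` is the edge `e_j`, it is
`(-1) ^ rho σ i` times (`σ` with `v_{j+1}` at `i`, minus `σ` with `v_j` at `i`); otherwise `0`. -/
def faceTerm (i : Fin n) (σ : VETuple k n) : VETuple k n →₀ ℤ :=
  match σ i with
  | Sum.inl _ => 0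
  | Sum.inr j => (-1 : ℤ) ^ rho σ i •
      (Finsupp.single (Function.update σ i (Sum.inl (j + 1))) 1
        - Finsupp.single (Function.update σ i (Sum.inl j)) 1)

/-- Linear extension of `faceTerm i`. -/
def bdAt (i : Fin n) : (VETuple k n →₀ ℤ) →ₗ[ℤ] (VETuple k n →₀ ℤ) :=
  Finsupp.linearCombination ℤ (faceTerm i)

/-- The cubical boundary operator on the chains of the `n`-th power of the cycle graph. -/
def bd : (VETuple k n →₀ ℤ) →ₗ[ℤ] (VETuple k n →₀ ℤ) := ∑ i, bdAt i

lemma faceTerm_inl {i : Fin n} {σ : VETuple k n} {j : ZMod k} (h : σ i = Sum.inl j) :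
    faceTerm i σ = 0 := by
  simp [faceTerm, h]

lemma faceTerm_inr {i : Fin n} {σ : VETuple k n} {j : ZMod k} (h : σ i = Sum.inr j) :
    faceTerm i σ = (-1 : ℤ) ^ rho σ i •
      (Finsupp.single (Function.update σ i (Sum.inl (j + 1))) 1
        - Finsupp.single (Function.update σ i (Sum.inl j)) 1) := by
  simp [faceTerm, h]

lemma bdAt_single (i : Fin n) (σ : VETuple k n) :
    bdAt i (Finsupp.single σ 1) = faceTerm i σ := by
  simp [bdAt]

lemma bd_single (σ : VETuple k n) : bd (Finsupp.single σ 1) = ∑ i, faceTerm i σ := by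
  simp [bd, bdAt_single]

lemma dim_update {σ : VETuple k n} {i : Fin n} {j : ZMod k} (h : σ i = Sum.inr j) (v : ZMod k) :
    dim (Function.update σ i (Sum.inl v)) + 1 = dim σ := by
  have h1 : (Finset.univ.filter fun l => (σ l).isRight = true)
      = insert i (Finset.univ.filter fun l =>
          (Function.update σ i (Sum.inl v) l).isRight = true) := by
    ext l
    by_cases hl : l = i
    · subst hl; simp [h]
    · simp [hl]
  unfold dim
  rw [h1, Finset.card_insert_of_notMem (by simp)]

lemma rho_update_gt {σ : VETuple k n} {i l : Fin n} {j : ZMod k} (h : σ i = Sum.inr j)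
    (hil : i < l) (v : ZMod k) :
    rho (Function.update σ i (Sum.inl v)) l + 1 = rho σ l := by
  have h1 : (Finset.univ.filter fun m => m < l ∧ (σ m).isRight = true)
      = insert i (Finset.univ.filter fun m => m < l ∧
          (Function.update σ i (Sum.inl v) m).isRight = true) := by
    ext m
    by_cases hm : m = i
    · subst hm; simp [h, hil]
    · simp [hm]
  unfold rho
  rw [h1, Finset.card_insert_of_notMem (by simp)]

lemma rho_update_le {σ : VETuple k n} {i l : Fin n} (hil : l ≤ i) (x : VE k) :
    rho (Function.update σ i x) l = rho σ l := by
  unfold rho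
  congr 1
  ext m
  by_cases hm : m = i
  · subst hm; simp [not_lt.mpr hil]
  · simp [hm]

lemma bdAt_anticomm_lt {i l : Fin n} (hil : i < l) (σ : VETuple k n) :
    bdAt i (faceTerm l σ) = - bdAt l (faceTerm i σ) := by
  have hne : i ≠ l := hil.ne
  rcases hi : σ i with a | a <;> rcases hl : σ l with b | b
  · simp [faceTerm_inl hi, faceTerm_inl hl]
  · have h1 (w : ZMod k) : faceTerm i (Function.update σ l (Sum.inl w)) = 0 :=
      faceTerm_inl (j := a) (by simp [hne, hi])
    simp [faceTerm_inl hi, faceTerm_inr hl, bdAt_single, h1]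
  · have h1 (w : ZMod k) : faceTerm l (Function.update σ i (Sum.inl w)) = 0 :=
      faceTerm_inl (j := b) (by simp [hne.symm, hl])
    simp [faceTerm_inl hl, faceTerm_inr hi, bdAt_single, h1]
  · have h1 (w : ZMod k) := faceTerm_inr (i := i) (σ := Function.update σ l (Sum.inl w)) (j := a)
      (by simp [hne, hi])
    have h2 (w : ZMod k) := faceTerm_inr (i := l) (σ := Function.update σ i (Sum.inl w)) (j := b)
      (by simp [hne.symm, hl])
    have h3 (w : ZMod k) := rho_update_gt hi hil w
    have h4 (w : ZMod k) : rho (Function.update σ l (Sum.inl w)) i = rho σ i :=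
      rho_update_le hil.le _
    have h5 (w : ZMod k) : (-1 : ℤ) ^ rho σ l
        = - (-1 : ℤ) ^ rho (Function.update σ i (Sum.inl w)) l := by
      rw [← h3 w, pow_succ]; ring
    have h6 (w : ZMod k) : (-1 : ℤ) ^ rho (Function.update σ i (Sum.inl w)) l
        = - (-1 : ℤ) ^ rho σ l := by rw [h5 w]; ring
    rw [faceTerm_inr hi, faceTerm_inr hl]
    simp only [map_smul, map_sub, bdAt_single, h1, h2, h4, h6]
    simp only [Function.update_comm hne]
    module

lemma bdAt_self (i : Fin n) (σ : VETuple k n) : bdAt i (faceTerm i σ) = 0 := by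
  rcases hi : σ i with a | a
  · simp [faceTerm_inl hi]
  · have h1 (w : ZMod k) : faceTerm i (Function.update σ i (Sum.inl w)) = 0 :=
      faceTerm_inl (j := w) (by simp)
    simp [faceTerm_inr hi, bdAt_single, h1]

lemma bdAt_anticomm (i l : Fin n) (σ : VETuple k n) :
    bdAt i (faceTerm l σ) = - bdAt l (faceTerm i σ) := by
  rcases lt_trichotomy i l with h | h | h
  · exact bdAt_anticomm_lt h σ
  · subst h; simp [bdAt_self]
  · rw [bdAt_anticomm_lt h σ, neg_neg]

lemma bd_bd_single (σ : VETuple k n) : bd (bd (Finsupp.single σ 1)) = 0 := by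
  have h : bd (bd (Finsupp.single σ 1)) = ∑ i, ∑ l, bdAt i (faceTerm l σ) := by
    rw [bd_single]; simp only [bd, map_sum, LinearMap.sum_apply]; exact Finset.sum_comm
  have h' : bd (bd (Finsupp.single σ 1)) = - bd (bd (Finsupp.single σ 1)) := by
    conv_lhs => rw [h, Finset.sum_comm]
    rw [h, ← Finset.sum_neg_distrib]
    refine Finset.sum_congr rfl fun i _ => ?_
    rw [← Finset.sum_neg_distrib]
    exact Finset.sum_congr rfl fun l _ => bdAt_anticomm l i σ
  ext τ
  have := DFunLike.congr_fun h' τ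
  simp only [Finsupp.neg_apply, Finsupp.coe_zero, Pi.zero_apply] at this ⊢
  omega

lemma isFace_update {σ : VETuple k n} {i : Fin n} {j v : ZMod k} (h : σ i = Sum.inr j)
    (hv : v = j ∨ v = j + 1) : IsFace (Function.update σ i (Sum.inl v)) σ := by
  intro l
  by_cases hl : l = i
  · subst hl
    right
    exact ⟨j, h, by simpa using hv⟩
  · left; simp [hl]

lemma isFace_of_bd_ne_zero {σ τ : VETuple k n} (h : bd (Finsupp.single σ 1) τ ≠ 0) :
    IsFace τ σ ∧ dim τ + 1 = dim σ := by
  rw [bd_single, Finsupp.finsetSum_apply] at h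
  obtain ⟨i, -, hi⟩ := Finset.exists_ne_zero_of_sum_ne_zero h
  rcases hs : σ i with a | a
  · simp [faceTerm_inl hs] at hi
  · rw [faceTerm_inr hs] at hi
    by_cases h1 : Function.update σ i (Sum.inl (a + 1)) = τ
    · subst h1
      exact ⟨isFace_update hs (Or.inr rfl), dim_update hs _⟩
    · by_cases h2 : Function.update σ i (Sum.inl a) = τ
      · subst h2
        exact ⟨isFace_update hs (Or.inl rfl), dim_update hs _⟩
      · simp [h1, h2] at hi

/-! ### The chain complex spanned by a convex set of cells -/

/-- A set of cells is convex if it contains every cell lying between two of its members in the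
face relation. -/
def IsConvex (S : Set (VETuple k n)) : Prop :=
  ∀ ⦃ρ τ σ : VETuple k n⦄, ρ ∈ S → σ ∈ S → IsFace ρ τ → IsFace τ σ → τ ∈ S

/-- The generators in degree `d`: the tuples in `S` of dimension `d`. -/
abbrev Gen (S : Set (VETuple k n)) (d : ℤ) : Type := {σ : VETuple k n // σ ∈ S ∧ (dim σ : ℤ) = d}

/-- The projection of chains that keeps only the generators from `S` in degree `e`. -/
def projGen (S : Set (VETuple k n)) (e : ℤ) : (VETuple k n →₀ ℤ) →ₗ[ℤ] (Gen S e →₀ ℤ) :=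
  Finsupp.lsubtypeDomain {σ : VETuple k n | σ ∈ S ∧ (dim σ : ℤ) = e}

lemma projGen_apply (S : Set (VETuple k n)) (e : ℤ) (y : VETuple k n →₀ ℤ) (τ : Gen S e) :
    projGen S e y τ = y τ.1 := rfl

/-- The cubical boundary operator from degree `d` to degree `e`, in which only the generators from
`S` are kept. -/
def bdRes (S : Set (VETuple k n)) (d e : ℤ) : (Gen S d →₀ ℤ) →ₗ[ℤ] (Gen S e →₀ ℤ) :=
  projGen S e ∘ₗ bd ∘ₗ
    Finsupp.lmapDomain ℤ ℤ (Subtype.val : Gen S d → VETuple k n)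

lemma bdRes_single_apply (S : Set (VETuple k n)) (d e : ℤ) (σ : Gen S d) (τ : Gen S e) :
    bdRes S d e (Finsupp.single σ 1) τ = bd (Finsupp.single σ.1 1) τ.1 := by
  simp [bdRes, projGen_apply]

lemma bdRes_eq_zero (S : Set (VETuple k n)) (d e : ℤ) (h : e + 1 ≠ d) : bdRes S d e = 0 := by
  refine Finsupp.lhom_ext' fun σ => LinearMap.ext_ring ?_
  ext τ
  simp only [LinearMap.comp_apply, Finsupp.lsingle_apply, bdRes_single_apply,
    LinearMap.zero_apply, Finsupp.coe_zero, Pi.zero_apply]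
  by_contra h0
  have h1 := (isFace_of_bd_ne_zero h0).2
  have h2 := σ.2.2
  have h3 := τ.2.2
  omega

lemma bdRes_comp (S : Set (VETuple k n)) (hS : IsConvex S) (d e f : ℤ) (hde : e + 1 = d) :
    bdRes S e f ∘ₗ bdRes S d e = 0 := by
  classical
  refine Finsupp.lhom_ext' fun σ => LinearMap.ext_ring ?_
  ext ρ
  set x := bd (Finsupp.single σ.1 1) with hx
  have key (y : VETuple k n →₀ ℤ) (hy : ∀ τ, y τ ≠ 0 → IsFace τ σ.1 ∧ (dim τ : ℤ) = e) :
      bdRes S e f (projGen S e y) ρ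
        = bd y ρ.1 := by
    induction y using Finsupp.induction with
    | zero => simp
    | single_add τ a y hτ ha ih =>
      have hyτ : y τ = 0 := Finsupp.notMem_support_iff.mp hτ
      have hτ' := hy τ (by simpa [hyτ] using ha)
      have ih' := ih fun τ' h' => hy τ' (by
        by_cases hc : τ' = τ
        · subst hc; exact absurd hyτ h'
        · simpa [Finsupp.single_apply, Ne.symm hc] using h')
      rw [map_add, map_add, map_add, Finsupp.add_apply, Finsupp.add_apply, ih']
      congr 1
      have hs : Finsupp.single τ a = a • Finsupp.single τ (1 : ℤ) := by simp
      rw [hs, map_smul, map_smul, map_smul, Finsupp.smul_apply, Finsupp.smul_apply]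
      congr 1
      by_cases hτS : τ ∈ S
      · have : projGen S e (Finsupp.single τ (1 : ℤ))
            = Finsupp.single (⟨τ, hτS, hτ'.2⟩ : Gen S e) (1 : ℤ) := by
          ext τ'
          simp [projGen_apply, Finsupp.single_apply, Subtype.ext_iff]
        rw [this]
        exact bdRes_single_apply S e f ⟨τ, hτS, hτ'.2⟩ ρ
      · have : projGen S e (Finsupp.single τ (1 : ℤ)) = (0 : Gen S e →₀ ℤ) := by
          ext τ'
          have : τ ≠ τ'.1 := fun hc => hτS (hc ▸ τ'.2.1)
          simp [projGen_apply, this]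
        rw [this, map_zero, Finsupp.coe_zero, Pi.zero_apply]
        by_contra h0
        exact hτS (hS ρ.2.1 σ.2.1 (isFace_of_bd_ne_zero (Ne.symm h0)).1 hτ'.1)
  have hfin := key x fun τ hτ => by
    have h1 := isFace_of_bd_ne_zero hτ
    have h2 := σ.2.2
    exact ⟨h1.1, by omega⟩
  have hσ : bdRes S d e (Finsupp.single σ 1)
      = projGen S e x := by
    simp [bdRes, hx]
  simp only [LinearMap.comp_apply, Finsupp.lsingle_apply, hσ, LinearMap.zero_apply,
    Finsupp.coe_zero, Pi.zero_apply]
  rw [hfin, hx, bd_bd_single]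
  simp

/-- The `ℤ`-graded chain complex of free abelian groups generated by the cells in a convex set
`S`, with the cubical boundary operator in which faces outside `S` are discarded. -/
def cellComplex (S : Set (VETuple k n)) (hS : IsConvex S) : ChainComplex (ModuleCat.{0} ℤ) ℤ where
  X d := ModuleCat.of ℤ (Gen S d →₀ ℤ)
  d i j := ModuleCat.ofHom (bdRes S i j)
  shape i j h := by
    rw [bdRes_eq_zero S i j (by simpa using h)]
    rfl
  d_comp_d' i j l hij _ := by
    rw [← ModuleCat.ofHom_comp, bdRes_comp S hS i j l (by simpa using hij)]
    rfl

/-! ### The complexes `C^{P,q}` -/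

/-- The generating tuples: `supp_V(σ) ⊆ P` and `|supp_V(σ)| ≥ q`. -/
def genSet (k n : ℕ) (P : Set (ZMod k)) (q : ℕ) : Set (VETuple k n) :=
  {σ | suppV σ ⊆ P ∧ q ≤ (suppV σ).ncard}

lemma suppV_finite (σ : VETuple k n) : (suppV σ).Finite := by
  refine ((Set.finite_range σ).preimage (f := (Sum.inl : ZMod k → VE k))
    Sum.inl_injective.injOn).subset ?_
  rintro j ⟨i, hi⟩
  exact ⟨i, hi⟩

lemma suppV_mono {τ σ : VETuple k n} (h : IsFace τ σ) : suppV σ ⊆ suppV τ := by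
  rintro j ⟨i, hi⟩
  rcases h i with h1 | ⟨j', h1, -⟩
  · exact ⟨i, h1.trans hi⟩
  · rw [hi] at h1; cases h1

lemma genSet_convex (P : Set (ZMod k)) (q : ℕ) : IsConvex (genSet k n P q) :=
  fun _ τ _ hρ hσ h1 h2 => ⟨(suppV_mono h1).trans hρ.1,
    hσ.2.trans (Set.ncard_le_ncard (suppV_mono h2) (suppV_finite τ))⟩

/-- The chain complex `C^{P,q}` of vertex-edge `n`-tuples. Replacing an edge of a generator by an
endpoint `v_j` gives a generator exactly when `j ∈ P`, because the vertex support can only grow;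
so the boundary operator keeps precisely the faces whose new vertex has its index in `P`. -/
def complexPq (k n : ℕ) (P : Set (ZMod k)) (q : ℕ) : ChainComplex (ModuleCat.{0} ℤ) ℤ :=
  cellComplex (genSet k n P q) (genSet_convex P q)

/-! ### The geometric realization: cells of the torus `(ℝ / kℤ)^n` -/

/-- The vertex `v_j` of the cycle graph realized as `ℝ / kℤ`: the class of the integer `j`. -/
def vertexPt (k : ℕ) (j : ZMod k) : AddCircle (k : ℝ) := (((j.cast : ℤ) : ℝ) : AddCircle (k : ℝ))

/-- The closed cells of the cycle graph: vertices, and the images of the intervals `[j, j+1]`. -/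
def closedCell₁ (k : ℕ) : VE k → Set (AddCircle (k : ℝ))
  | Sum.inl j => {vertexPt k j}
  | Sum.inr j => (fun t : ℝ => (t : AddCircle (k : ℝ))) ''
      Set.Icc ((j.cast : ℤ) : ℝ) (((j.cast : ℤ) : ℝ) + 1)

/-- The closed cell of the product `(ℝ / kℤ)^n` indexed by a vertex-edge tuple. -/
def closedCell (σ : VETuple k n) : Set (Fin n → AddCircle (k : ℝ)) :=
  {x | ∀ i, x i ∈ closedCell₁ k (σ i)}

/-- The cells of the product cubical structure that lie in a given subspace. -/
def cellsIn (A : Set (Fin n → AddCircle (k : ℝ))) : Set (VETuple k n) := {σ | closedCell σ ⊆ A}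

lemma vertexPt_add_one (j : ZMod k) :
    vertexPt k (j + 1) = ((((j.cast : ℤ) : ℝ) + 1 : ℝ) : AddCircle (k : ℝ)) := by
  have h : (((j + 1).cast : ℤ) : ZMod k) = ((j.cast + 1 : ℤ) : ZMod k) := by
    simp
  obtain ⟨c, hc⟩ := (ZMod.intCast_eq_intCast_iff_dvd_sub _ _ _).mp h
  have h2 : ((j.cast : ℤ) : ℝ) + 1 = (((j + 1).cast : ℤ) : ℝ) + c • (k : ℝ) := by
    have : ((j.cast + 1 - (j + 1).cast : ℤ) : ℝ) = ((k * c : ℤ) : ℝ) := by rw [hc]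
    push_cast at this
    simp only [zsmul_eq_mul]
    linarith
  rw [vertexPt, h2, AddCircle.coe_add, AddCircle.coe_zsmul, AddCircle.coe_period]
  simp

lemma closedCell_mono {τ σ : VETuple k n} (h : IsFace τ σ) : closedCell τ ⊆ closedCell σ := by
  intro x hx i
  have hxi := hx i
  rcases h i with h1 | ⟨j, h1, h2 | h2⟩
  · rwa [h1] at hxi
  · rw [h2] at hxi
    rw [h1]
    exact ⟨_, ⟨le_refl _, by linarith⟩, hxi.symm⟩
  · rw [h2] at hxi
    rw [h1]
    exact ⟨_, ⟨by linarith, le_refl _⟩, ((hxi : x i = _).trans (vertexPt_add_one j)).symm⟩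

lemma cellsIn_convex (A : Set (Fin n → AddCircle (k : ℝ))) : IsConvex (cellsIn A) :=
  fun _ _ _ _ hσ _ h2 => (closedCell_mono h2).trans hσ

/-- The cubical chain complex of a subspace `A` of the torus `(ℝ / kℤ)^n` that is a union of
closed cells: it is generated by the cells contained in `A`. -/
def cubicalComplex (A : Set (Fin n → AddCircle (k : ℝ))) : ChainComplex (ModuleCat.{0} ℤ) ℤ :=
  cellComplex (cellsIn A) (cellsIn_convex A)

/-- `Ω(k,n,q)`: the generalized anchored configuration space of `n` points on the cycle graph with
`k` vertices, anchored at the set of all its vertices. -/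
def Omega (k n q : ℕ) : Set (Fin n → AddCircle (k : ℝ)) := gacs (Set.range (vertexPt k)) n q

end AnchoredConf

end

noncomputable section

namespace AnchoredConf

section

variable {k n : ℕ}

/-! ### Matrices indexed by the cells of the cycle graph -/

/-! A chain is treated as an integer function on all vertex-edge tuples. All functions together form
the cellular complex of the torus, whose homology in degree `i` has rank `n.choose i`. The complex
in question is the subcomplex of functions vanishing on tuples with fewer than `q` distinct
vertices. The theorem reduces to acyclicity of the quotient, formed by the tuples with few vertices,
in every degree `d ≤ n - q`: by the long exact sequence, sub- and full complex then have the same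
homology in degrees below `n - q`. This transfer is done by hand in `exists_bdFun_eq_of_vanishOn`
and `exists_vanishOn_cycle_with_periods`.

Acyclicity of the quotient. For a proper subset `S` of the vertices, the tuples with support inside
`S` span the `n`-th tensor power of the two-term complex from all edges to the vertices in `S`. Its
differential is onto: join each vertex of `S` by a path to a vertex outside `S`, which is discarded.
So all homology sits in degree `n` (`exactRel_powerset`). Induction on the size of `S` isolates the
tuples with support exactly `S`, each smaller size costing one degree, and lower families of
supports are then assembled one maximal set at a time (`exactRel_of_card_lt`).

Homology of the torus. Retracting the coordinates one by one turns a cycle into a reduced one,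
determined by one integer for each set of edge positions (`exists_reduced`, `IsReduced.eq_zero`).
The periods vanish on boundaries and read off these integers.

Outside `0 ≤ i ≤ n - q` the chain groups are zero, since `dim σ` plus the number of distinct
vertices is at most `n`. The geometric claims hold because the centre of a cell meets no vertices
other than those listed in its tuple (`cellsIn_Omega`). -/

/-- A matrix is odd if it exchanges vertices and edges. -/
def IsOdd (A : Matrix (VE k) (VE k) ℤ) : Prop :=
  ∀ u w, A u w ≠ 0 → u.isRight ≠ w.isRight

lemma sign_update_of_ne {τ : VETuple k n} {i l : Fin n} (hil : i < l) {w : VE k}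
    (hw : (τ i).isRight ≠ w.isRight) :
    (-1 : ℤ) ^ rho (Function.update τ i w) l = - (-1) ^ rho τ l := by
  rcases hi : τ i with a | a <;> rcases w with b | b
  · simp [hi] at hw
  -- `rho_update_gt` only turns edges into vertices, so it is applied to the updated tuple and
  -- undone.
  · have h := rho_update_gt (σ := Function.update τ i (Sum.inr b)) (i := i) (l := l) (j := b)
      (by simp) hil a
    rw [Function.update_idem, ← hi, Function.update_eq_self] at h
    rw [← h, pow_succ]; ring
  · have h := rho_update_gt hi hil b
    rw [← h, pow_succ]; ring
  · simp [hi] at hw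

/-- The boundary matrix of the cycle graph. -/
def bdMat (k : ℕ) : Matrix (VE k) (VE k) ℤ
  | Sum.inl a, Sum.inr b => (if a = b + 1 then 1 else 0) - (if a = b then 1 else 0)
  | _, _ => 0

/-- The matrix sending each vertex to a chain of edges. -/
def pathMat (h : ZMod k → ZMod k → ℤ) : Matrix (VE k) (VE k) ℤ
  | Sum.inr e, Sum.inl b => h e b
  | _, _ => 0

lemma bdMat_odd : IsOdd (bdMat k) := by
  rintro (a | a) (b | b) h <;> simp_all [bdMat]

lemma pathMat_odd (h : ZMod k → ZMod k → ℤ) : IsOdd (pathMat h) := by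
  rintro (a | a) (b | b) h <;> simp_all [pathMat]

variable [NeZero k]

/-! ### Operators acting on one coordinate of a function on tuples -/

/-- The operator on functions of tuples that applies the matrix `A` to the coordinate `i`. -/
def coordOp (A : Matrix (VE k) (VE k) ℤ) (i : Fin n) :
    (VETuple k n → ℤ) →ₗ[ℤ] (VETuple k n → ℤ) where
  toFun x τ := ∑ w, A (τ i) w * x (Function.update τ i w)
  map_add' x y := by
    ext τ; simp [mul_add, Finset.sum_add_distrib]
  map_smul' c x := by
    ext τ; simp only [Pi.smul_apply, smul_eq_mul, Finset.mul_sum, mul_left_comm, RingHom.id_apply]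

/-- The operator `coordOp A i` with the cubical sign of the coordinate `i`. -/
def signedOp (A : Matrix (VE k) (VE k) ℤ) (i : Fin n) :
    (VETuple k n → ℤ) →ₗ[ℤ] (VETuple k n → ℤ) where
  toFun x τ := (-1) ^ rho τ i * coordOp A i x τ
  map_add' x y := by
    ext τ; simp [mul_add]
  map_smul' c x := by
    ext τ; simp only [map_smul, Pi.smul_apply, smul_eq_mul, mul_left_comm, RingHom.id_apply]

lemma coordOp_apply (A : Matrix (VE k) (VE k) ℤ) (i : Fin n) (x : VETuple k n → ℤ)
    (τ : VETuple k n) : coordOp A i x τ = ∑ w, A (τ i) w * x (Function.update τ i w) := rfl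

lemma signedOp_apply (A : Matrix (VE k) (VE k) ℤ) (i : Fin n) (x : VETuple k n → ℤ)
    (τ : VETuple k n) : signedOp A i x τ = (-1) ^ rho τ i * coordOp A i x τ := rfl

lemma coordOp_add_matrix (A B : Matrix (VE k) (VE k) ℤ) (i : Fin n) (x : VETuple k n → ℤ) :
    coordOp (A + B) i x = coordOp A i x + coordOp B i x := by
  ext τ; simp [coordOp_apply, add_mul, Finset.sum_add_distrib]

lemma coordOp_sub_matrix (A B : Matrix (VE k) (VE k) ℤ) (i : Fin n) (x : VETuple k n → ℤ) :
    coordOp (A - B) i x = coordOp A i x - coordOp B i x := by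
  ext τ; simp [coordOp_apply, sub_mul, Finset.sum_sub_distrib]

lemma coordOp_one (i : Fin n) (x : VETuple k n → ℤ) :
    coordOp (1 : Matrix (VE k) (VE k) ℤ) i x = x := by
  ext τ; simp [coordOp_apply, Matrix.one_apply]

lemma signedOp_signedOp_self (A B : Matrix (VE k) (VE k) ℤ) (i : Fin n)
    (x : VETuple k n → ℤ) : signedOp A i (signedOp B i x) = coordOp (A * B) i x := by
  ext τ
  have hs : (-1 : ℤ) ^ rho τ i * (-1) ^ rho τ i = 1 := by
    rw [← mul_pow]; simp
  simp only [signedOp_apply, coordOp_apply, rho_update_le le_rfl, Function.update_self,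
    Function.update_idem, Matrix.mul_apply, Finset.sum_mul, Finset.mul_sum]
  rw [Finset.sum_comm]
  refine Finset.sum_congr rfl fun u _ => Finset.sum_congr rfl fun w _ => ?_
  linear_combination (A (τ i) w * (B w u * x (Function.update τ i u))) * hs

/-- Only the operator at the earlier coordinate must be odd: it alters the sign seen at `l`, whereas
changing the entry at `l` leaves the sign at `i` alone. -/
lemma signedOp_anticomm_lt {A B : Matrix (VE k) (VE k) ℤ} (hA : IsOdd A) {i l : Fin n}
    (hil : i < l) (x : VETuple k n → ℤ) :
    signedOp A i (signedOp B l x) = - signedOp B l (signedOp A i x) := by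
  ext τ
  simp only [signedOp_apply, coordOp_apply, Pi.neg_apply, Finset.mul_sum,
    Function.update_of_ne hil.ne, Function.update_of_ne hil.ne', rho_update_le hil.le]
  rw [Finset.sum_comm, ← Finset.sum_neg_distrib]
  refine Finset.sum_congr rfl fun u _ => ?_
  rw [← Finset.sum_neg_distrib]
  refine Finset.sum_congr rfl fun w _ => ?_
  by_cases h : A (τ i) w = 0
  · simp [h]
  · rw [sign_update_of_ne hil (hA _ _ h), Function.update_comm hil.ne]
    ring

lemma signedOp_anticomm {A B : Matrix (VE k) (VE k) ℤ} (hA : IsOdd A) (hB : IsOdd B)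
    {i l : Fin n} (hil : i ≠ l) (x : VETuple k n → ℤ) :
    signedOp A i (signedOp B l x) = - signedOp B l (signedOp A i x) := by
  rcases lt_or_gt_of_ne hil with h | h
  · exact signedOp_anticomm_lt hA h x
  · rw [signedOp_anticomm_lt hB h x, neg_neg]

/-! ### The boundary operator on functions -/

/-- The cubical boundary operator on functions. -/
def bdFun (k n : ℕ) [NeZero k] : (VETuple k n → ℤ) →ₗ[ℤ] (VETuple k n → ℤ) :=
  ∑ i, signedOp (bdMat k) i

lemma bdFun_eq_sum (x : VETuple k n → ℤ) : bdFun k n x = ∑ i, signedOp (bdMat k) i x := by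
  simp [bdFun]

lemma bdFun_apply (x : VETuple k n → ℤ) (τ : VETuple k n) :
    bdFun k n x τ = ∑ i, signedOp (bdMat k) i x τ := by
  simp [bdFun]

lemma signedOp_bdMat_inr {x : VETuple k n → ℤ} {τ : VETuple k n} {i : Fin n} {b : ZMod k}
    (h : τ i = Sum.inr b) : signedOp (bdMat k) i x τ = 0 := by
  simp [signedOp_apply, coordOp_apply, h, bdMat]

lemma sum_bdMat_inl_mul (a : ZMod k) (g : ZMod k → ℤ) :
    ∑ b, bdMat k (Sum.inl a) (Sum.inr b) * g b = g (a - 1) - g a := by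
  have h (b : ZMod k) : a = b + 1 ↔ a - 1 = b := by rw [sub_eq_iff_eq_add]
  simp [bdMat, sub_mul, Finset.sum_sub_distrib, h]

lemma signedOp_bdMat_inl {x : VETuple k n → ℤ} {τ : VETuple k n} {i : Fin n} {a : ZMod k}
    (h : τ i = Sum.inl a) : signedOp (bdMat k) i x τ = (-1) ^ rho τ i *
      (x (Function.update τ i (Sum.inr (a - 1))) - x (Function.update τ i (Sum.inr a))) := by
  rw [signedOp_apply, coordOp_apply, h, Fintype.sum_sum_type,
    sum_bdMat_inl_mul a fun b => x (Function.update τ i (Sum.inr b))]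
  simp [bdMat]

lemma faceTerm_apply (i : Fin n) (σ τ : VETuple k n) :
    faceTerm i σ τ = signedOp (bdMat k) i (Pi.single σ 1) τ := by
  -- Only the summand `w = σ i` can be nonzero, and only if `σ` and `τ` agree away from `i`.
  have hu (w : VE k) : Function.update τ i w = σ ↔ w = σ i ∧ Function.update σ i (τ i) = τ := by
    constructor
    · rintro rfl; simp
    · rintro ⟨rfl, h⟩
      rw [← h]; simp
  rw [signedOp_apply, coordOp_apply]
  simp only [Pi.single_apply, hu]
  rw [Finset.sum_eq_single (σ i) (fun w _ hw => by simp [hw]) (by simp)]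
  rcases hs : σ i with j | j
  · rw [faceTerm_inl hs]
    rcases τ i with a | a <;> simp [bdMat]
  · rw [faceTerm_inr hs]
    have hτ (v : ZMod k) : Function.update σ i (Sum.inl v) = τ ↔
        τ i = Sum.inl v ∧ Function.update σ i (τ i) = τ := by
      constructor
      · rintro rfl; simp
      · rintro ⟨h, h'⟩; rw [← h, h']
    have hrho (h : Function.update σ i (τ i) = τ) : rho σ i = rho τ i := by
      rw [← h, rho_update_le le_rfl]
    simp only [Finsupp.smul_apply, Finsupp.sub_apply, Finsupp.single_apply, hτ, smul_eq_mul]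
    by_cases h : Function.update σ i (τ i) = τ
    · rw [hrho h]
      rcases hi : τ i with a | a
      · rw [hi] at h
        simp [h, bdMat]
      · simp [bdMat]
    · simp [h]

lemma bd_apply (x : VETuple k n →₀ ℤ) : ⇑(bd x) = bdFun k n ⇑x := by
  induction x using Finsupp.induction_linear with
  | zero => simp
  | add x y hx hy => simp [hx, hy]
  | single σ a =>
    have h : Finsupp.single σ a = a • Finsupp.single σ (1 : ℤ) := by simp
    rw [h, map_smul, Finsupp.coe_smul, Finsupp.coe_smul, map_smul, bd_single]
    congr 1
    ext τ
    rw [bdFun_apply, Finsupp.finsetSum_apply]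
    refine Finset.sum_congr rfl fun i _ => ?_
    rw [faceTerm_apply, Finsupp.single_eq_pi_single]

lemma bdFun_bdFun (x : VETuple k n → ℤ) : bdFun k n (bdFun k n x) = 0 := by
  have h : ∀ y : VETuple k n →₀ ℤ, bd (bd y) = 0 := fun y => by
    have : (bd ∘ₗ bd : (VETuple k n →₀ ℤ) →ₗ[ℤ] _) = 0 :=
      Finsupp.lhom_ext' fun σ => LinearMap.ext_ring (by simpa using bd_bd_single σ)
    exact DFunLike.congr_fun this y
  have hx := congrArg (fun y : VETuple k n →₀ ℤ => ⇑y) (h (Finsupp.equivFunOnFinite.symm x))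
  simpa [bd_apply] using hx

/-- By anticommutation the boundary terms at the other coordinates cancel, leaving a homotopy
formula for a single copy of the cycle graph. -/
lemma bdFun_homotopy (h : ZMod k → ZMod k → ℤ) (i : Fin n) (x : VETuple k n → ℤ) :
    bdFun k n (signedOp (pathMat h) i x) + signedOp (pathMat h) i (bdFun k n x) =
      coordOp (bdMat k * pathMat h + pathMat h * bdMat k) i x := by
  rw [bdFun_eq_sum, bdFun_eq_sum, map_sum, ← Finset.sum_add_distrib,
    Finset.sum_eq_single i, signedOp_signedOp_self, signedOp_signedOp_self, coordOp_add_matrix]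
  · intro l _ hl
    rw [signedOp_anticomm bdMat_odd (pathMat_odd h) hl, neg_add_cancel]
  · simp

/-! ### Retractions of one coordinate -/

/-- The matrix of `retractOp`. -/
def retractMat (h : ZMod k → ZMod k → ℤ) : Matrix (VE k) (VE k) ℤ :=
  1 - (bdMat k * pathMat h + pathMat h * bdMat k)

/-- The operator homotopic to the identity through the homotopy given by `h` on coordinate `i`. -/
def retractOp (h : ZMod k → ZMod k → ℤ) (i : Fin n) :
    (VETuple k n → ℤ) →ₗ[ℤ] (VETuple k n → ℤ) :=
  coordOp (retractMat h) i

lemma retractOp_eq (h : ZMod k → ZMod k → ℤ) (i : Fin n) (x : VETuple k n → ℤ) :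
    retractOp h i x = x - bdFun k n (signedOp (pathMat h) i x)
      - signedOp (pathMat h) i (bdFun k n x) := by
  rw [retractOp, retractMat, coordOp_sub_matrix, coordOp_one, ← bdFun_homotopy]
  abel

/-- For every base vertex `c` there are chains of edges with boundary `v_b - v_c`. -/
lemma exists_path (c : ZMod k) : ∃ h : ZMod k → ZMod k → ℤ, ∀ a b,
    h (a - 1) b - h a b = (if a = b then 1 else 0) - (if a = c then 1 else 0) := by
  have key (m : ℕ) : ∃ g : ZMod k → ℤ, ∀ a,
      g (a - 1) - g a = (if a = c + m then 1 else 0) - (if a = c then 1 else 0) := by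
    induction m with
    | zero => exact ⟨0, by simp⟩
    | succ m ih =>
      obtain ⟨g, hg⟩ := ih
      -- The path to `v_{c+m}` is extended by the edge `e_{c+m}`.
      refine ⟨fun a => g a + if a = c + m then 1 else 0, fun a => ?_⟩
      have h1 : a - 1 = c + m ↔ a = c + (m + 1 : ℕ) := by
        rw [sub_eq_iff_eq_add]; push_cast; rw [add_assoc]
      have := hg a
      simp only [h1]
      linarith
  have key' (b : ZMod k) : ∃ g : ZMod k → ℤ, ∀ a,
      g (a - 1) - g a = (if a = b then 1 else 0) - (if a = c then 1 else 0) := by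
    obtain ⟨g, hg⟩ := key (b - c).val
    refine ⟨g, fun a => ?_⟩
    rw [hg a, ZMod.natCast_zmod_val, add_sub_cancel]
  choose g hg using key'
  exact ⟨fun a b => g b a, fun a b => hg b a⟩

/-- For `h` from `exists_path c` this entry is `1` if `a = c` and `0` otherwise: every vertex is
sent to `v_c`. -/
lemma retractMat_inl_inl (h : ZMod k → ZMod k → ℤ) (a b : ZMod k) :
    retractMat h (Sum.inl a) (Sum.inl b) = (if a = b then 1 else 0) - (h (a - 1) b - h a b) := by
  rw [← sum_bdMat_inl_mul a fun e => h e b]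
  simp [retractMat, Matrix.mul_apply, Matrix.one_apply, pathMat, bdMat]

lemma retractMat_inl_inr (h : ZMod k → ZMod k → ℤ) (a b : ZMod k) :
    retractMat h (Sum.inl a) (Sum.inr b) = 0 := by
  simp [retractMat, Matrix.mul_apply, pathMat, bdMat]

lemma retractMat_inr_inl (h : ZMod k → ZMod k → ℤ) (a b : ZMod k) :
    retractMat h (Sum.inr a) (Sum.inl b) = 0 := by
  simp [retractMat, Matrix.mul_apply, pathMat, bdMat]

lemma retractMat_inr_inr (h : ZMod k → ZMod k → ℤ) (a b : ZMod k) :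
    retractMat h (Sum.inr a) (Sum.inr b) =
      (if a = b then 1 else 0) - (h a (b + 1) - h a b) := by
  simp [retractMat, Matrix.mul_apply, Matrix.one_apply, pathMat, bdMat, mul_sub,
    Finset.sum_sub_distrib]

lemma retractOp_apply_inl (h : ZMod k → ZMod k → ℤ) {i : Fin n} {τ : VETuple k n} {a : ZMod k}
    (hτ : τ i = Sum.inl a) (x : VETuple k n → ℤ) : retractOp h i x τ =
      ∑ b, ((if a = b then 1 else 0) - (h (a - 1) b - h a b))
        * x (Function.update τ i (Sum.inl b)) := by
  simp only [← retractMat_inl_inl]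
  change coordOp (retractMat h) i x τ = _
  rw [coordOp_apply, hτ, Fintype.sum_sum_type]
  simp [retractMat_inl_inr]

lemma retractOp_apply_inr (h : ZMod k → ZMod k → ℤ) {i : Fin n} {τ : VETuple k n} {a : ZMod k}
    (hτ : τ i = Sum.inr a) (x : VETuple k n → ℤ) : retractOp h i x τ =
      ∑ b, ((if a = b then 1 else 0) - (h a (b + 1) - h a b))
        * x (Function.update τ i (Sum.inr b)) := by
  simp only [← retractMat_inr_inr]
  change coordOp (retractMat h) i x τ = _
  rw [coordOp_apply, hτ, Fintype.sum_sum_type]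
  simp [retractMat_inr_inl]

end

section

variable {k n : ℕ} [NeZero k]

/-! ### Homogeneous parts and vertex supports -/

/-- The homogeneous part of degree `d` of a function on tuples. -/
def homPart (d : ℕ) (x : VETuple k n → ℤ) : VETuple k n → ℤ :=
  fun τ => if dim τ = d then x τ else 0

/-- A function on tuples is homogeneous of degree `d` if it is supported in dimension `d`. -/
def IsHom (d : ℕ) (x : VETuple k n → ℤ) : Prop := ∀ τ, x τ ≠ 0 → dim τ = d

omit [NeZero k] in
lemma isHom_homPart (d : ℕ) (x : VETuple k n → ℤ) : IsHom d (homPart d x) := by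
  intro τ h
  by_contra h'
  simp [homPart, h'] at h

omit [NeZero k] in
lemma IsHom.homPart_eq {d : ℕ} {x : VETuple k n → ℤ} (h : IsHom d x) : homPart d x = x := by
  ext τ
  by_cases h' : dim τ = d
  · simp [homPart, h']
  · simp [homPart, h', not_not.mp (mt (h τ) h')]

omit [NeZero k] in
lemma dim_update_inr {τ : VETuple k n} {i : Fin n} {a : ZMod k} (h : τ i = Sum.inl a)
    (b : ZMod k) : dim (Function.update τ i (Sum.inr b)) = dim τ + 1 := by
  rw [← dim_update (σ := Function.update τ i (Sum.inr b)) (i := i) (j := b) (by simp) a,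
    Function.update_idem, ← h, Function.update_eq_self]

lemma bdFun_homPart (d : ℕ) (x : VETuple k n → ℤ) :
    bdFun k n (homPart (d + 1) x) = homPart d (bdFun k n x) := by
  ext τ
  have h (i : Fin n) : signedOp (bdMat k) i (homPart (d + 1) x) τ =
      if dim τ = d then signedOp (bdMat k) i x τ else 0 := by
    rcases hi : τ i with a | a
    · rw [signedOp_bdMat_inl hi, signedOp_bdMat_inl hi]
      simp only [homPart, dim_update_inr hi, Nat.add_right_cancel_iff]
      split_ifs <;> simp
    · simp [signedOp_bdMat_inr hi]
  simp only [bdFun_apply, h, homPart]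
  split_ifs <;> simp

/-- The vertex support as a finset. -/
def vsupp (σ : VETuple k n) : Finset (ZMod k) := {j | ∃ i, σ i = Sum.inl j}

lemma mem_vsupp {σ : VETuple k n} {j : ZMod k} : j ∈ vsupp σ ↔ ∃ i, σ i = Sum.inl j := by
  simp [vsupp]

lemma ncard_suppV (σ : VETuple k n) : (suppV σ).ncard = (vsupp σ).card := by
  rw [← Set.ncard_coe_finset]
  congr 1
  ext j
  simp [suppV, mem_vsupp]

lemma vsupp_update_inr_subset (τ : VETuple k n) (i : Fin n) (b : ZMod k) :
    vsupp (Function.update τ i (Sum.inr b)) ⊆ vsupp τ := by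
  intro j
  simp only [mem_vsupp]
  rintro ⟨l, hl⟩
  by_cases h : l = i
  · subst h; simp at hl
  · exact ⟨l, by simpa [h] using hl⟩

lemma vsupp_update_inl_subset (τ : VETuple k n) (i : Fin n) (b : ZMod k) :
    vsupp (Function.update τ i (Sum.inl b)) ⊆ insert b (vsupp τ) := by
  intro j
  simp only [mem_vsupp, Finset.mem_insert]
  rintro ⟨l, hl⟩
  by_cases h : l = i
  · subst h; left; simpa using hl.symm
  · exact Or.inr ⟨l, by simpa [h] using hl⟩

/-- The function vanishes on all tuples whose vertex support belongs to the family `F`. -/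
def VanishOn (F : Finset (Finset (ZMod k))) (x : VETuple k n → ℤ) : Prop :=
  ∀ τ, vsupp τ ∈ F → x τ = 0

lemma VanishOn.mono {F G : Finset (Finset (ZMod k))} (h : F ⊆ G) {x : VETuple k n → ℤ}
    (hx : VanishOn G x) : VanishOn F x := fun τ hτ => hx τ (h hτ)

lemma VanishOn.add {F : Finset (Finset (ZMod k))} {x y : VETuple k n → ℤ}
    (hx : VanishOn F x) (hy : VanishOn F y) : VanishOn F (x + y) := fun τ hτ => by
  simp [hx τ hτ, hy τ hτ]

lemma VanishOn.sub {F : Finset (Finset (ZMod k))} {x y : VETuple k n → ℤ}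
    (hx : VanishOn F x) (hy : VanishOn F y) : VanishOn F (x - y) := fun τ hτ => by
  simp [hx τ hτ, hy τ hτ]

lemma VanishOn.homPart {F : Finset (Finset (ZMod k))} {x : VETuple k n → ℤ}
    (hx : VanishOn F x) (d : ℕ) : VanishOn F (homPart d x) := fun τ hτ => by
  simp [AnchoredConf.homPart, hx τ hτ]

/-- The value of the boundary at `τ` only involves tuples with a vertex of `τ` turned into an edge,
whose supports are smaller. Hence a lower family `F` cuts out a subcomplex. -/
lemma VanishOn.bdFun {F : Finset (Finset (ZMod k))} (hF : IsLowerSet (F : Set (Finset (ZMod k))))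
    {x : VETuple k n → ℤ} (hx : VanishOn F x) : VanishOn F (bdFun k n x) := by
  intro τ hτ
  have h (i : Fin n) (b : ZMod k) : x (Function.update τ i (Sum.inr b)) = 0 :=
    hx _ (hF (vsupp_update_inr_subset τ i b) hτ)
  rw [bdFun_apply]
  refine Finset.sum_eq_zero fun i _ => ?_
  rcases hi : τ i with a | a
  · simp [signedOp_bdMat_inl hi, h]
  · exact signedOp_bdMat_inr hi

/-- Relative to the functions vanishing on `F`, every homogeneous cycle of degree `d` is a
boundary. -/
def ExactRel (n : ℕ) (F : Finset (Finset (ZMod k))) (d : ℕ) : Prop :=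
  ∀ x : VETuple k n → ℤ, IsHom d x → VanishOn F (bdFun k n x) →
    ∃ y, IsHom (d + 1) y ∧ VanishOn F (x - bdFun k n y)

/-- Taking homogeneous parts removes the need to track degrees, and a remainder `z` is harmless if
its part of degree `d` vanishes on `F`. -/
lemma exactRel_of_exists {F : Finset (Finset (ZMod k))} {d : ℕ}
    (h : ∀ x : VETuple k n → ℤ, IsHom d x → VanishOn F (bdFun k n x) →
      ∃ y z, VanishOn F (homPart d z) ∧ VanishOn F (x - bdFun k n y - z)) : ExactRel n F d := by
  intro x hx hb
  obtain ⟨y, z, hz, hy⟩ := h x hx hb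
  refine ⟨homPart (d + 1) y, isHom_homPart _ _, ?_⟩
  rw [bdFun_homPart]
  intro τ hτ
  have h1 := hz τ hτ
  have h2 := hy τ hτ
  have h3 := congrFun hx.homPart_eq τ
  simp only [homPart, Pi.sub_apply] at h1 h2 h3 ⊢
  rw [← h3]
  split_ifs at h1 ⊢
  · linarith
  · simp

/-! ### Tuples with vertex support in a proper subset -/

lemma vanishOn_signedOp_pathMat {S : Finset (ZMod k)} {h : ZMod k → ZMod k → ℤ}
    (hS : ∀ e b, b ∉ S → h e b = 0) {x : VETuple k n → ℤ} (hx : VanishOn S.powerset x)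
    (i : Fin n) : VanishOn S.powerset (signedOp (pathMat h) i x) := by
  intro τ hτ
  rw [signedOp_apply, coordOp_apply, Finset.sum_eq_zero, mul_zero]
  intro w _
  rcases hi : τ i with a | a <;> rcases w with b | b
  · simp [pathMat]
  · simp [pathMat]
  · by_cases hb : b ∈ S
    · rw [hx, mul_zero]
      rw [Finset.mem_powerset] at hτ ⊢
      exact (vsupp_update_inl_subset τ i b).trans (Finset.insert_subset hb hτ)
    · simp [pathMat, hS a b hb]
  · simp [pathMat]

lemma exactRel_powerset {S : Finset (ZMod k)} (hS : S ≠ Finset.univ) {d : ℕ} (hd : d < n) :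
    ExactRel n S.powerset d := by
  obtain ⟨c, hc⟩ : ∃ c, c ∉ S := by
    by_contra! hc
    exact hS (Finset.eq_univ_of_forall hc)
  obtain ⟨g, hg⟩ := exists_path c
  -- Truncating the paths to end vertices in `S` makes the homotopy preserve vanishing on the
  -- subsets of `S`.
  set h : ZMod k → ZMod k → ℤ := fun a b => if b ∈ S then g a b else 0 with hh
  have hlow : IsLowerSet (S.powerset : Set (Finset (ZMod k))) := by
    intro A B hBA hA
    simp only [Finset.coe_powerset, Set.mem_preimage, Set.mem_powerset_iff,
      Finset.coe_subset] at hA ⊢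
    exact hBA.trans hA
  have hS0 : ∀ e b, b ∉ S → h e b = 0 := fun e b hb => by simp [hh, hb]
  -- The retraction sends vertices to `v_c`, and `c ∉ S`, so its rows at vertices of `S` are zero.
  have hdiag (a b : ZMod k) (ha : a ∈ S) :
      (if a = b then (1 : ℤ) else 0) - (h (a - 1) b - h a b) = 0 := by
    have hac : a ≠ c := fun hac => hc (hac ▸ ha)
    by_cases hb : b ∈ S
    · simp [hh, hb, hg, hac]
    · have : a ≠ b := fun hab => hb (hab ▸ ha)
      simp [hh, hb, this]
  refine exactRel_of_exists fun x hx hb => ?_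
  have key (s : Finset (Fin n)) : ∃ y z, VanishOn S.powerset (x - bdFun k n y - z) ∧
      ∀ τ, vsupp τ ⊆ S → ∀ i ∈ s, (τ i).isLeft = true → z τ = 0 := by
    induction s using Finset.induction_on with
    | empty => exact ⟨0, x, by simp [VanishOn], by simp⟩
    | insert i s _ ih =>
      obtain ⟨y, z, h1, h2⟩ := ih
      have hz : VanishOn S.powerset (bdFun k n z) := by
        have := hb.sub (h1.bdFun hlow)
        simpa [bdFun_bdFun] using this
      refine ⟨y + signedOp (pathMat h) i z, retractOp h i z, ?_, ?_⟩
      · have h3 := h1.add (vanishOn_signedOp_pathMat hS0 hz i)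
        rw [retractOp_eq, map_add]
        convert h3 using 1
        abel
      · intro τ hτ l hl hleft
        rcases hi : τ i with a | a
        · have ha : a ∈ S := hτ (mem_vsupp.mpr ⟨i, hi⟩)
          rw [retractOp_apply_inl h hi]
          exact Finset.sum_eq_zero fun b _ => by rw [hdiag a b ha, zero_mul]
        · have hli : l ≠ i := by
            rintro rfl
            simp [hi] at hleft
          rw [retractOp_apply_inr h hi]
          refine Finset.sum_eq_zero fun b _ => ?_
          rw [h2 _ ((vsupp_update_inr_subset τ i b).trans hτ) l
            ((Finset.mem_insert.mp hl).resolve_left hli) (by simpa [hli] using hleft), mul_zero]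
  obtain ⟨y, z, h1, h2⟩ := key Finset.univ
  refine ⟨y, z, fun τ hτ => ?_, h1⟩
  by_cases hτd : dim τ = d
  · obtain ⟨i, hi⟩ : ∃ i, (τ i).isLeft = true := by
      by_contra! hall
      have : dim τ = n := by
        unfold dim
        rw [Finset.filter_true_of_mem fun i _ => by simpa using hall i]
        simp
      omega
    simp [homPart, h2 τ (Finset.mem_powerset.mp hτ) i (Finset.mem_univ i) hi]
  · simp [homPart, hτd]

/-! ### Tuples with few vertices -/

omit [NeZero k] in
lemma isLowerSet_ssubsets (S : Finset (ZMod k)) :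
    IsLowerSet (S.ssubsets : Set (Finset (ZMod k))) := by
  intro A B hBA hA
  simp only [Finset.mem_coe, Finset.mem_ssubsets] at hA ⊢
  exact lt_of_le_of_lt hBA hA

/-- Exactness for the tuples with vertex support exactly `S`. -/
lemma exists_of_vanishOn_ssubsets {S : Finset (ZMod k)} (hS : S ≠ Finset.univ) {d : ℕ}
    (hd : d < n) (hE : ExactRel n S.ssubsets (d + 1)) {x : VETuple k n → ℤ} (hx : IsHom d x)
    (hxS : VanishOn S.ssubsets x) (hb : VanishOn S.powerset (bdFun k n x)) :
    ∃ y, VanishOn S.ssubsets y ∧ VanishOn S.powerset (x - bdFun k n y) := by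
  obtain ⟨y, hy, hxy⟩ := exactRel_powerset hS hd x hx hb
  have hsub : S.ssubsets ⊆ S.powerset := fun A hA =>
    Finset.mem_powerset.mpr (Finset.mem_ssubsets.mp hA).subset
  -- The primitive `y` is a relative cycle of degree `d + 1` over the proper subsets of `S`;
  -- subtracting a boundary makes it vanish there without changing `bdFun k n y`.
  have hby : VanishOn S.ssubsets (bdFun k n y) := by
    simpa using hxS.sub (hxy.mono hsub)
  obtain ⟨z, -, hz⟩ := hE y hy hby
  exact ⟨y - bdFun k n z, hz, by simpa [bdFun_bdFun] using hxy⟩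

lemma exactRel_of_card_lt {F : Finset (Finset (ZMod k))} {d : ℕ}
    (hF : IsLowerSet (F : Set (Finset (ZMod k)))) (hd : ∀ S ∈ F, S ≠ Finset.univ ∧ d + S.card < n) :
    ExactRel n F d := by
  -- The outer induction bounds the sizes of the supports, the inner one counts the members of `F`.
  -- The degree stays free, because the proper subsets of `S` are needed in degree `d + 1`; their
  -- smaller size keeps `d + S.card < n` true.
  have key (s : ℕ) : ∀ (F : Finset (Finset (ZMod k))) (d : ℕ),
      IsLowerSet (F : Set (Finset (ZMod k))) → (∀ S ∈ F, S ≠ Finset.univ ∧ d + S.card < n) →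
      (∀ S ∈ F, S.card < s) → ExactRel n F d := by
    induction s with
    | zero =>
      intro F d _ _ hs x _ _
      exact ⟨0, by simp [IsHom], fun τ hτ => absurd (hs _ hτ) (by simp)⟩
    | succ s ih =>
      intro F
      induction hm : F.card generalizing F with
      | zero =>
        intro d _ _ _ x _ _
        exact ⟨0, by simp [IsHom], fun τ hτ => by simp [Finset.card_eq_zero.mp hm] at hτ⟩
      | succ m ihm =>
        intro d hF hd hs
        have hne : F.Nonempty := Finset.card_pos.mp (by omega)
        obtain ⟨S, hSmax⟩ := F.exists_maximal hne
        have hSF : S ∈ F := hSmax.prop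
        have hlow : IsLowerSet ((F.erase S : Finset _) : Set (Finset (ZMod k))) := by
          intro A B hBA hA
          simp only [Finset.coe_erase, Set.mem_sdiff, Finset.mem_coe,
            Set.mem_singleton_iff] at hA ⊢
          refine ⟨hF hBA hA.1, ?_⟩
          rintro rfl
          exact hA.2 (le_antisymm (hSmax.le_of_ge hA.1 hBA) hBA)
        have hpow : S.powerset ⊆ F := fun A hA => hF (Finset.mem_powerset.mp hA) hSF
        have hss : S.ssubsets ⊆ F.erase S := by
          intro A hA
          rw [Finset.mem_ssubsets] at hA
          exact Finset.mem_erase.mpr ⟨hA.ne, hF hA.le hSF⟩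
        have hE : ExactRel n S.ssubsets (d + 1) := by
          refine ih _ _ (isLowerSet_ssubsets S) (fun A hA => ?_) fun A hA => ?_
          all_goals
            rw [Finset.mem_ssubsets] at hA
            have hc := Finset.card_lt_card hA
          · have := (hd S hSF).2
            exact ⟨fun h => (hA.trans_le (Finset.subset_univ S)).ne h, by omega⟩
          · have := hs S hSF
            omega
        refine exactRel_of_exists fun x hx hb => ?_
        obtain ⟨y, hy, hxy⟩ := ihm (F.erase S) (by rw [Finset.card_erase_of_mem hSF, hm]; rfl) d hlow
          (fun A hA => hd A (Finset.mem_of_mem_erase hA))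
          (fun A hA => hs A (Finset.mem_of_mem_erase hA)) x hx (hb.mono (Finset.erase_subset _ _))
        have hx'hom : IsHom d (x - bdFun k n y) := by
          rw [← hx.homPart_eq, ← hy.homPart_eq, bdFun_homPart]
          intro τ hτ
          by_contra h
          simp [homPart, h] at hτ
        obtain ⟨z, hz, hxz⟩ := exists_of_vanishOn_ssubsets (hd S hSF).1
          (by have := (hd S hSF).2; omega) hE hx'hom (hxy.mono hss)
          (by simpa [bdFun_bdFun] using hb.mono hpow)
        -- Only the part of `z` with support exactly `S` is kept: the rest vanishes on all subsets
        -- of `S`, and this part does not disturb what was achieved on `F.erase S`.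
        set z' : VETuple k n → ℤ := fun τ => if vsupp τ = S then z τ else 0 with hz'
        have h1 : VanishOn S.powerset (z - z') := by
          intro τ hτ
          by_cases h : vsupp τ = S
          · simp [hz', h]
          · have := hz τ (Finset.mem_ssubsets.mpr
              ((Finset.mem_powerset.mp hτ).ssubset_of_ne h))
            simp [hz', h, this]
        have h2 : VanishOn (F.erase S) z' := by
          intro τ hτ
          simp [hz', Finset.ne_of_mem_erase hτ]
        have h3 : VanishOn S.powerset (x - bdFun k n (y + z')) := by
          have hlp : IsLowerSet (S.powerset : Set (Finset (ZMod k))) := by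
            intro A B hBA hA
            simp only [Finset.mem_coe, Finset.mem_powerset] at hA ⊢
            exact hBA.trans hA
          have := hxz.add (h1.bdFun hlp)
          convert this using 1
          simp only [map_add, map_sub]
          abel
        have h4 : VanishOn (F.erase S) (x - bdFun k n (y + z')) := by
          have := hxy.sub (h2.bdFun hlow)
          convert this using 1
          simp only [map_add]
          abel
        refine ⟨y + z', 0, by simp [VanishOn, homPart], fun τ hτ => ?_⟩
        by_cases h : vsupp τ = S
        · simpa using h3 τ (by simp [h])
        · simpa using h4 τ (Finset.mem_erase.mpr ⟨h, hτ⟩)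
  exact key (F.sup Finset.card + 1) F d hF hd fun S hS => Nat.lt_succ_of_le (Finset.le_sup hS)

end

section

variable {k n : ℕ} [NeZero k]

/-! ### Cycles of the torus -/

/-- A function is reduced at `i` if it is supported on tuples whose `i`-th entry is an edge or the
vertex `v_0`, and does not depend on the edge at `i`. -/
def IsReduced (i : Fin n) (x : VETuple k n → ℤ) : Prop :=
  (∀ τ a, τ i = Sum.inl a → a ≠ 0 → x τ = 0) ∧
    ∀ τ a b, x (Function.update τ i (Sum.inr a)) = x (Function.update τ i (Sum.inr b))

lemma eq_of_shift_invariant {f : ZMod k → ℤ} (hf : ∀ a, f (a - 1) = f a) (a b : ZMod k) :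
    f a = f b := by
  have key (m : ℕ) : f (b + m) = f b := by
    induction m with
    | zero => simp
    | succ m ih => rw [← ih, ← hf]; congr 1; push_cast; ring
  have := key (a - b).val
  rwa [ZMod.natCast_zmod_val, add_sub_cancel] at this

/-- Each boundary term is a difference of values at two neighbouring edges in the same coordinate.
-/
lemma IsReduced.bdFun_eq_zero {x : VETuple k n → ℤ} (hx : ∀ i, IsReduced i x) :
    bdFun k n x = 0 := by
  ext τ
  rw [bdFun_apply]
  refine Finset.sum_eq_zero fun i _ => ?_
  rcases hi : τ i with a | a
  · rw [signedOp_bdMat_inl hi, (hx i).2 τ (a - 1) a, sub_self, mul_zero]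
  · exact signedOp_bdMat_inr hi

lemma exists_reduced {x : VETuple k n → ℤ} (hb : bdFun k n x = 0) :
    ∃ y z, x = bdFun k n y + z ∧ ∀ i, IsReduced i z := by
  obtain ⟨g, hg⟩ := exists_path (0 : ZMod k)
  -- The retraction sends an edge to a cycle of the cycle graph, and such a cycle has the same
  -- coefficient on every edge.
  have hedge (b a a' : ZMod k) : (if a = b then (1 : ℤ) else 0) - (g a (b + 1) - g a b) =
      (if a' = b then 1 else 0) - (g a' (b + 1) - g a' b) := by
    refine eq_of_shift_invariant
      (f := fun a => (if a = b then (1 : ℤ) else 0) - (g a (b + 1) - g a b)) (fun a => ?_) a a'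
    have h1 := hg a (b + 1)
    have h2 := hg a b
    have h3 : a - 1 = b ↔ a = b + 1 := sub_eq_iff_eq_add
    simp only [h3]
    linarith
  have key (s : Finset (Fin n)) : ∃ y z, x = bdFun k n y + z ∧ ∀ i ∈ s, IsReduced i z := by
    induction s using Finset.induction_on with
    | empty => exact ⟨0, x, by simp, by simp⟩
    | insert i s _ ih =>
      obtain ⟨y, z, h1, h2⟩ := ih
      have hz : bdFun k n z = 0 := by
        have := congrArg (bdFun k n) h1
        rwa [hb, map_add, bdFun_bdFun, zero_add, eq_comm] at this
      refine ⟨y + signedOp (pathMat g) i z, retractOp g i z, ?_, fun l hl => ?_⟩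
      · rw [retractOp_eq, hz, map_zero, sub_zero, map_add, h1]
        abel
      · rcases eq_or_ne l i with rfl | hli
        · refine ⟨fun τ a hτ ha => ?_, fun τ a b => ?_⟩
          · rw [retractOp_apply_inl g hτ]
            exact Finset.sum_eq_zero fun b _ => by simp [hg, ha]
          · rw [retractOp_apply_inr g (a := a) (by simp),
              retractOp_apply_inr g (a := b) (by simp)]
            exact Finset.sum_congr rfl fun c _ => by
              rw [hedge c a b, Function.update_idem, Function.update_idem]
        · obtain ⟨h3, h4⟩ := h2 l ((Finset.mem_insert.mp hl).resolve_left hli)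
          refine ⟨fun τ a hτ ha => ?_, fun τ a b => ?_⟩
          · rw [retractOp, coordOp_apply]
            exact Finset.sum_eq_zero fun w _ => by
              rw [h3 _ a (by simpa [hli] using hτ) ha, mul_zero]
          · rw [retractOp, coordOp_apply, coordOp_apply]
            refine Finset.sum_congr rfl fun w _ => ?_
            rw [Function.update_of_ne hli.symm, Function.update_of_ne hli.symm,
              Function.update_comm hli, Function.update_comm hli, h4 _ a b]
  obtain ⟨y, z, h1, h2⟩ := key Finset.univ
  exact ⟨y, z, h1, fun i => h2 i (Finset.mem_univ i)⟩

omit [NeZero k] in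
lemma IsReduced.homPart {i : Fin n} {x : VETuple k n → ℤ} (hx : IsReduced i x) (d : ℕ) :
    IsReduced i (homPart d x) := by
  refine ⟨fun τ a hτ ha => by simp [AnchoredConf.homPart, hx.1 τ a hτ ha], fun τ a b => ?_⟩
  have h (a : ZMod k) : dim (Function.update τ i (Sum.inl 0)) + 1
      = dim (Function.update τ i (Sum.inr a)) := by
    rw [← dim_update (σ := Function.update τ i (Sum.inr a)) (i := i) (j := a) (by simp) 0,
      Function.update_idem]
  simp only [AnchoredConf.homPart, ← h, hx.2 τ a b]

/-- The tuple with `e_0` at the positions in `I` and `v_0` elsewhere. -/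
def torusTuple (k : ℕ) (I : Finset (Fin n)) : VETuple k n :=
  fun i => if i ∈ I then Sum.inr 0 else Sum.inl 0

omit [NeZero k] in
lemma dim_torusTuple (I : Finset (Fin n)) : dim (torusTuple k I) = I.card := by
  unfold dim
  congr 1
  ext i
  rw [Finset.mem_filter]
  by_cases h : i ∈ I <;> simp [torusTuple, h]

/-- The set of positions of edges. -/
def edgeSet (σ : VETuple k n) : Finset (Fin n) := {i | (σ i).isRight = true}

/-- All vertex entries may be taken to be `v_0`, and the edge entries can be replaced by `e_0` one
position at a time. -/
lemma IsReduced.eq_zero {x : VETuple k n → ℤ} (hx : ∀ i, IsReduced i x)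
    (h : ∀ I, x (torusTuple k I) = 0) : x = 0 := by
  ext σ
  by_cases hv : ∃ i a, σ i = Sum.inl a ∧ a ≠ 0
  · obtain ⟨i, a, hi, ha⟩ := hv
    exact (hx i).1 σ a hi ha
  · push Not at hv
    have key (s : Finset (Fin n)) : x (s.piecewise (torusTuple k (edgeSet σ)) σ) = x σ := by
      induction s using Finset.induction_on with
      | empty => simp
      | insert i s hi ih =>
        rw [Finset.piecewise_insert, ← ih]
        have hρ : s.piecewise (torusTuple k (edgeSet σ)) σ i = σ i := by simp [hi]
        rcases hs : σ i with a | a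
        · have : torusTuple k (edgeSet σ) i = s.piecewise (torusTuple k (edgeSet σ)) σ i := by
            rw [hρ]; simp [torusTuple, edgeSet, hs, hv i a hs]
          rw [this, Function.update_eq_self]
        · have : torusTuple k (edgeSet σ) i = Sum.inr 0 := by simp [torusTuple, edgeSet, hs]
          rw [this, (hx i).2 _ 0 a, ← hs, ← hρ, Function.update_eq_self]
    rw [← key Finset.univ, Finset.piecewise_univ, h]
    rfl

/-! ### Periods of torus chains -/

/-- The cells over which the `I`-th period of a chain is taken: `e_0` at the positions in `I`, and
arbitrary vertices elsewhere. -/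
def periodCells (k : ℕ) [NeZero k] (I : Finset (Fin n)) : Finset (VETuple k n) :=
  {σ | ∀ i, if i ∈ I then σ i = Sum.inr 0 else (σ i).isLeft = true}

/-- The `I`-th period of a chain of the torus. -/
def period (k : ℕ) [NeZero k] (I : Finset (Fin n)) : (VETuple k n → ℤ) →ₗ[ℤ] ℤ where
  toFun x := ∑ σ ∈ periodCells k I, x σ
  map_add' x y := by simp [Finset.sum_add_distrib]
  map_smul' c x := by simp [Finset.mul_sum]

lemma period_apply (I : Finset (Fin n)) (x : VETuple k n → ℤ) :
    period k I x = ∑ σ ∈ periodCells k I, x σ := rfl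

lemma mem_periodCells {I : Finset (Fin n)} {σ : VETuple k n} : σ ∈ periodCells k I ↔
    ∀ i, if i ∈ I then σ i = Sum.inr 0 else (σ i).isLeft = true := by
  simp [periodCells]

/-- Translation of the `i`-th entry. -/
def shiftAt (i : Fin n) (c : ZMod k) (σ : VETuple k n) : VETuple k n :=
  Function.update σ i (Sum.map (· + c) (· + c) (σ i))

lemma shiftAt_mem_periodCells {I : Finset (Fin n)} {i : Fin n} (hi : i ∉ I) (c : ZMod k)
    {σ : VETuple k n} (hσ : σ ∈ periodCells k I) : shiftAt i c σ ∈ periodCells k I := by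
  rw [mem_periodCells] at hσ ⊢
  intro l
  have := hσ l
  by_cases h : l = i
  · subst h; simpa [hi, shiftAt] using this
  · simpa [shiftAt, h] using this

omit [NeZero k] in
lemma shiftAt_shiftAt {i : Fin n} {c c' : ZMod k} (h : c + c' = 0) (σ : VETuple k n) :
    shiftAt i c' (shiftAt i c σ) = σ := by
  rcases hs : σ i with a | a <;> simp [shiftAt, hs, add_assoc, h]
-- At positions in `I` the boundary term vanishes because the entry is an edge. At the others the
-- two halves of the term differ by a translation of that entry, which permutes `periodCells`.
lemma period_bdFun (I : Finset (Fin n)) (x : VETuple k n → ℤ) :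
    period k I (bdFun k n x) = 0 := by
  rw [period_apply]
  simp only [bdFun_apply]
  rw [Finset.sum_comm]
  refine Finset.sum_eq_zero fun i _ => ?_
  by_cases hi : i ∈ I
  · refine Finset.sum_eq_zero fun σ hσ => ?_
    have := mem_periodCells.mp hσ i
    rw [if_pos hi] at this
    exact signedOp_bdMat_inr this
  · set f : VETuple k n → ℤ := fun σ => (-1) ^ rho σ i *
      x (Function.update σ i (Sum.inr ((σ i).elim id id))) with hf
    have h1 : ∀ σ ∈ periodCells k I, signedOp (bdMat k) i x σ = f (shiftAt i (-1) σ) - f σ := by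
      intro σ hσ
      have := mem_periodCells.mp hσ i
      rw [if_neg hi] at this
      obtain ⟨a, ha⟩ := Sum.isLeft_iff.mp this
      rw [signedOp_bdMat_inl ha]
      simp [hf, shiftAt, ha, rho_update_le, mul_add, sub_eq_add_neg]
    rw [Finset.sum_congr rfl h1, Finset.sum_sub_distrib, sub_eq_zero]
    exact Finset.sum_bij' (fun σ _ => shiftAt i (-1) σ) (fun σ _ => shiftAt i 1 σ)
      (fun σ hσ => shiftAt_mem_periodCells hi _ hσ)
      (fun σ hσ => shiftAt_mem_periodCells hi _ hσ)
      (fun σ _ => shiftAt_shiftAt (by simp) σ) (fun σ _ => shiftAt_shiftAt (by simp) σ)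
      (fun σ _ => rfl)

lemma torusTuple_mem_periodCells (I : Finset (Fin n)) : torusTuple k I ∈ periodCells k I := by
  rw [mem_periodCells]
  intro i
  by_cases h : i ∈ I <;> simp [torusTuple, h]

lemma IsReduced.period_eq {x : VETuple k n → ℤ} (hx : ∀ i, IsReduced i x)
    (I : Finset (Fin n)) : period k I x = x (torusTuple k I) := by
  rw [period_apply, Finset.sum_eq_single (torusTuple k I)]
  · intro σ hσ hne
    rw [mem_periodCells] at hσ
    obtain ⟨i, hi⟩ := Function.ne_iff.mp hne
    have h := hσ i
    by_cases hI : i ∈ I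
    · simp [hI] at h
      simp [torusTuple, hI, h] at hi
    · rw [if_neg hI] at h
      obtain ⟨a, ha⟩ := Sum.isLeft_iff.mp h
      refine (hx i).1 σ a ha ?_
      rintro rfl
      simp [torusTuple, hI, ha] at hi
  · exact fun h => absurd (torusTuple_mem_periodCells I) h

lemma IsHom.bdFun {d : ℕ} {x : VETuple k n → ℤ} (hx : IsHom (d + 1) x) :
    IsHom d (bdFun k n x) := by
  rw [← hx.homPart_eq, bdFun_homPart]
  exact isHom_homPart _ _

omit [NeZero k] in
lemma IsHom.sub {d : ℕ} {x y : VETuple k n → ℤ} (hx : IsHom d x) (hy : IsHom d y) :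
    IsHom d (x - y) := by
  intro τ hτ
  by_contra h
  have h1 := not_not.mp (mt (hx τ) h)
  have h2 := not_not.mp (mt (hy τ) h)
  simp [h1, h2] at hτ

/-- A homogeneous cycle of the torus with vanishing periods is a boundary. -/
lemma exists_bdFun_eq_of_period_eq_zero {d : ℕ} {x : VETuple k n → ℤ} (hx : IsHom d x)
    (hb : bdFun k n x = 0) (hp : ∀ I : Finset (Fin n), I.card = d → period k I x = 0) :
    ∃ y, IsHom (d + 1) y ∧ bdFun k n y = x := by
  obtain ⟨y, z, h1, h2⟩ := exists_reduced hb
  have h3 : x = bdFun k n (homPart (d + 1) y) + homPart d z := by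
    rw [bdFun_homPart, ← hx.homPart_eq, h1]
    ext τ
    simp only [homPart, Pi.add_apply]
    split_ifs <;> simp
  have h4 := fun i => (h2 i).homPart d
  have h5 : homPart d z = 0 := by
    refine IsReduced.eq_zero h4 fun I => ?_
    by_cases hI : I.card = d
    · have := hp I hI
      rwa [h3, map_add, period_bdFun, zero_add, IsReduced.period_eq h4] at this
    · simp [homPart, dim_torusTuple, hI]
  exact ⟨_, isHom_homPart _ _, by rw [h5, add_zero] at h3; exact h3.symm⟩

/-- There are homogeneous cycles of the torus with arbitrary periods. -/
lemma exists_cycle_with_periods (k : ℕ) [NeZero k] {d : ℕ} (c : Finset (Fin n) → ℤ) :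
    ∃ x : VETuple k n → ℤ, IsHom d x ∧ bdFun k n x = 0 ∧
      ∀ I : Finset (Fin n), I.card = d → period k I x = c I := by
  -- This is the reduced function with value `c I` at `torusTuple k I`.
  set z : VETuple k n → ℤ := fun σ => if ∀ i a, σ i = Sum.inl a → a = 0 then c (edgeSet σ) else 0
    with hz
  have hred (i : Fin n) : IsReduced i z := by
    refine ⟨fun τ a hτ ha => if_neg fun h => ha (h i a hτ), fun τ a b => ?_⟩
    have h1 : edgeSet (Function.update τ i (Sum.inr a : VE k)) =
        edgeSet (Function.update τ i (Sum.inr b)) := by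
      ext l
      by_cases hl : l = i
      · subst hl; simp [edgeSet]
      · simp [edgeSet, hl]
    have h2 (a b : ZMod k) (h : ∀ l c, Function.update τ i (Sum.inr a) l = Sum.inl c → c = 0) :
        ∀ l c, Function.update τ i (Sum.inr b) l = Sum.inl c → c = 0 := by
      intro l c hl
      by_cases hli : l = i
      · subst hli; simp at hl
      · exact h l c (by simpa [hli] using hl)
    simp only [hz, h1]
    exact if_congr ⟨h2 a b, h2 b a⟩ rfl rfl
  refine ⟨homPart d z, isHom_homPart _ _,
    IsReduced.bdFun_eq_zero fun i => (hred i).homPart d, fun I hI => ?_⟩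
  rw [IsReduced.period_eq fun i => (hred i).homPart d]
  have h1 : edgeSet (torusTuple k I) = I := by
    ext i
    rw [edgeSet, Finset.mem_filter]
    by_cases h : i ∈ I <;> simp [torusTuple, h]
  have h2 : ∀ i a, torusTuple k I i = Sum.inl a → a = 0 := by
    intro i a
    by_cases h : i ∈ I <;> simp [torusTuple, h, eq_comm]
  simp only [homPart, dim_torusTuple, hI, if_true, hz, h1]
  rw [if_pos h2]

/-! ### The subcomplex of tuples with at least `q` vertices -/

/-- The family of sets with fewer than `q` elements. -/
def smallSets (k : ℕ) [NeZero k] (q : ℕ) : Finset (Finset (ZMod k)) := {S | S.card < q}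

lemma mem_smallSets {q : ℕ} {S : Finset (ZMod k)} : S ∈ smallSets k q ↔ S.card < q := by
  simp [smallSets]

lemma isLowerSet_smallSets (q : ℕ) :
    IsLowerSet (smallSets k q : Set (Finset (ZMod k))) := by
  intro A B hBA hA
  rw [Finset.mem_coe, mem_smallSets] at hA ⊢
  exact (Finset.card_le_card hBA).trans_lt hA

lemma exactRel_smallSets {q d : ℕ} (hq : q ≤ k) (hd : d + q ≤ n) :
    ExactRel n (smallSets k q) d := by
  refine exactRel_of_card_lt (isLowerSet_smallSets q) fun S hS => ?_
  rw [mem_smallSets] at hS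
  refine ⟨?_, by omega⟩
  rintro rfl
  rw [Finset.card_univ, ZMod.card] at hS
  omega

lemma exists_bdFun_eq_of_vanishOn {q d : ℕ} (hq : q ≤ k) (hd : d + q < n)
    {x : VETuple k n → ℤ} (hx : IsHom d x) (hv : VanishOn (smallSets k q) x)
    (hb : bdFun k n x = 0) (hp : ∀ I : Finset (Fin n), I.card = d → period k I x = 0) :
    ∃ y, IsHom (d + 1) y ∧ VanishOn (smallSets k q) y ∧ bdFun k n y = x := by
  obtain ⟨y, hy, hyx⟩ := exists_bdFun_eq_of_period_eq_zero hx hb hp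
  obtain ⟨z, hz, hyz⟩ := exactRel_smallSets (d := d + 1) hq (by omega) y hy (by rwa [hyx])
  exact ⟨y - bdFun k n z, hy.sub hz.bdFun, hyz, by rw [map_sub, bdFun_bdFun, sub_zero, hyx]⟩

lemma exists_vanishOn_cycle_with_periods {q d : ℕ} (hq : q ≤ k) (hd : d + q < n)
    (c : Finset (Fin n) → ℤ) :
    ∃ x : VETuple k n → ℤ, IsHom d x ∧ VanishOn (smallSets k q) x ∧ bdFun k n x = 0 ∧
      ∀ I : Finset (Fin n), I.card = d → period k I x = c I := by
  obtain ⟨x, hx, hb, hp⟩ := exists_cycle_with_periods k (d := d) c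
  obtain ⟨y, hy, hxy⟩ := exactRel_smallSets (d := d) hq hd.le x hx
    (by rw [hb]; exact fun _ _ => rfl)
  refine ⟨x - bdFun k n y, hx.sub hy.bdFun, hxy, by rw [map_sub, bdFun_bdFun, sub_zero, hb],
    fun I hI => ?_⟩
  rw [map_sub, period_bdFun, sub_zero, hp I hI]

end

section

variable {k n : ℕ}

/-! ### Cells of the anchored configuration space -/

lemma coe_eq_coe_iff_exists {s t : ℝ} :
    (s : AddCircle (k : ℝ)) = t ↔ ∃ c : ℤ, s = t + c * k := by
  rw [← sub_eq_zero, ← AddCircle.coe_sub, AddCircle.coe_eq_zero_iff]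
  simp only [zsmul_eq_mul]
  exact exists_congr fun c => ⟨fun h => by linarith, fun h => by linarith⟩

lemma vertexPt_injective (k : ℕ) : Function.Injective (vertexPt k) := by
  intro a b h
  obtain ⟨c, hc⟩ := coe_eq_coe_iff_exists.mp h
  have h1 : (a.cast : ℤ) = (b.cast : ℤ) + c * k := by exact_mod_cast hc
  have h2 := congrArg (Int.cast : ℤ → ZMod k) h1
  simpa using h2

lemma vertexPt_intCast (k : ℕ) (m : ℤ) : vertexPt k (m : ZMod k) = ((m : ℝ) : AddCircle (k : ℝ)) := by
  obtain ⟨c, hc⟩ := (ZMod.intCast_eq_intCast_iff_dvd_sub m ((m : ZMod k).cast : ℤ) k).mp (by simp)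
  refine coe_eq_coe_iff_exists.mpr ⟨c, ?_⟩
  have : (((m : ZMod k).cast : ℤ) : ℝ) - m = k * c := by exact_mod_cast hc
  linarith

lemma exists_mem_closedCell₁ (p : AddCircle (k : ℝ)) :
    ∃ w : VE k, p ∈ closedCell₁ k w ∧ (p ∈ Set.range (vertexPt k) → w.isLeft = true) := by
  by_cases hp : p ∈ Set.range (vertexPt k)
  · obtain ⟨j, rfl⟩ := hp
    exact ⟨Sum.inl j, rfl, fun _ => rfl⟩
  · obtain ⟨t, rfl⟩ := QuotientAddGroup.mk_surjective p
    refine ⟨Sum.inr (⌊t⌋ : ZMod k), ?_, fun h => absurd h hp⟩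
    -- The multiple `c * k` moves `⌊t⌋` to the integer representative used by `closedCell₁`.
    obtain ⟨c, hc⟩ := coe_eq_coe_iff_exists.mp (vertexPt_intCast k ⌊t⌋)
    refine ⟨t + c * k, ⟨?_, ?_⟩, coe_eq_coe_iff_exists.mpr ⟨c, rfl⟩⟩
    · have := Int.floor_le t
      linarith
    · have := (Int.lt_floor_add_one t).le
      linarith

lemma mem_Omega_of_mem_closedCell {q : ℕ} {σ : VETuple k n} (hσ : q ≤ (suppV σ).ncard)
    {x : Fin n → AddCircle (k : ℝ)} (hx : x ∈ closedCell σ) : x ∈ Omega k n q := by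
  refine hσ.trans ?_
  rw [← Set.ncard_image_of_injective _ (vertexPt_injective k)]
  refine Set.ncard_le_ncard ?_ ((Set.finite_range x).inter_of_right _)
  rintro _ ⟨j, ⟨i, hi⟩, rfl⟩
  have := hx i
  rw [hi] at this
  exact ⟨⟨j, rfl⟩, i, this⟩

lemma le_ncard_suppV {q : ℕ} {σ : VETuple k n} {x : Fin n → AddCircle (k : ℝ)}
    (hx : x ∈ closedCell σ) (hv : ∀ i, x i ∈ Set.range (vertexPt k) → (σ i).isLeft = true)
    (hq : x ∈ Omega k n q) : q ≤ (suppV σ).ncard := by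
  refine le_trans hq ?_
  rw [← Set.ncard_image_of_injective (suppV σ) (vertexPt_injective k)]
  refine Set.ncard_le_ncard ?_ ((suppV_finite σ).image _)
  rintro p ⟨hp, i, rfl⟩
  obtain ⟨j, hj⟩ := Sum.isLeft_iff.mp (hv i hp)
  have := hx i
  rw [hj] at this
  exact ⟨j, ⟨i, hj⟩, this.symm⟩

lemma cellsIn_Omega (k n q : ℕ) : cellsIn (Omega k n q) = genSet k n Set.univ q := by
  ext σ
  refine ⟨fun h => ⟨Set.subset_univ _, ?_⟩, fun h x hx => mem_Omega_of_mem_closedCell h.2 hx⟩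
  -- The centre of the cell is the test point; midpoints of edges are not vertices, by parity after
  -- doubling.
  set x : Fin n → AddCircle (k : ℝ) := fun i => (σ i).elim (vertexPt k)
    (fun j => ((((j.cast : ℤ) : ℝ) + 1 / 2 : ℝ) : AddCircle (k : ℝ))) with hx
  have hcell : x ∈ closedCell σ := by
    intro i
    rcases hi : σ i with j | j
    · simp [hx, hi, closedCell₁]
    · refine ⟨((j.cast : ℤ) : ℝ) + 1 / 2, ⟨by linarith, by linarith⟩, ?_⟩
      simp [hx, hi]
  refine le_ncard_suppV hcell (fun i hi => ?_) (h hcell)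
  rcases hs : σ i with j | j
  · rfl
  · obtain ⟨j', hj'⟩ := hi
    simp only [hx, hs, Sum.elim_inr] at hj'
    obtain ⟨c, hc⟩ := coe_eq_coe_iff_exists.mp hj'
    have h1 : 2 * (j'.cast : ℤ) = 2 * (j.cast : ℤ) + 1 + 2 * (c * k) := by
      have : (2 : ℝ) * ((j'.cast : ℤ) : ℝ) = 2 * ((j.cast : ℤ) : ℝ) + 1 + 2 * (c * k) := by
        linarith
      exact_mod_cast this
    omega

lemma Omega_eq_iUnion (k n q : ℕ) :
    Omega k n q = ⋃ σ ∈ cellsIn (Omega k n q), closedCell σ := by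
  ext x
  simp only [Set.mem_iUnion, exists_prop]
  refine ⟨fun hx => ?_, fun ⟨σ, hσ, hx⟩ => hσ hx⟩
  choose σ h1 h2 using fun i => exists_mem_closedCell₁ (x i)
  refine ⟨σ, ?_, h1⟩
  rw [cellsIn_Omega]
  exact ⟨Set.subset_univ _, le_ncard_suppV h1 h2 hx⟩

lemma nonempty_iso_cubicalComplex (k n q : ℕ) :
    Nonempty (complexPq k n Set.univ q ≅ cubicalComplex (Omega k n q)) := by
  have h (S : Set (VETuple k n)) (hS : IsConvex S) (hSq : S = genSet k n Set.univ q) :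
      Nonempty (complexPq k n Set.univ q ≅ cellComplex S hS) := by
    subst hSq
    exact ⟨CategoryTheory.Iso.refl _⟩
  exact h _ _ (cellsIn_Omega k n q)

end

section

open CategoryTheory

/-! ### Homology of complexes of modules -/

/-- The first isomorphism theorem for `Φ` restricted to cycles; `Φ` itself may be defined on all
chains. -/
lemma nonempty_homology_linearEquiv {R : Type*} [CommRing R] (S : ShortComplex (ModuleCat R)) {N : Type*}
    [AddCommGroup N] [Module R N] (Φ : S.X₂ →ₗ[R] N) (hsurj : ∀ c, ∃ x, S.g.hom x = 0 ∧ Φ x = c)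
    (hker : ∀ x, S.g.hom x = 0 → (Φ x = 0 ↔ ∃ y, S.f.hom y = x)) :
    Nonempty (S.homology ≃ₗ[R] N) := by
  set Ψ : LinearMap.ker S.g.hom →ₗ[R] N := Φ ∘ₗ (LinearMap.ker S.g.hom).subtype with hΨ
  have h1 : Function.Surjective Ψ := fun c => by
    obtain ⟨x, hx, hc⟩ := hsurj c
    exact ⟨⟨x, hx⟩, hc⟩
  have h2 : LinearMap.range S.moduleCatToCycles = LinearMap.ker Ψ := by
    ext ⟨x, hx⟩
    rw [LinearMap.mem_ker]
    change _ ↔ Φ x = 0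
    rw [hker x hx]
    exact exists_congr fun y => Subtype.ext_iff
  exact ⟨S.moduleCatHomologyIso.toLinearEquiv ≪≫ₗ Submodule.quotEquivOfEq _ _ h2 ≪≫ₗ
    Ψ.quotKerEquivOfSurjective h1⟩

variable {k n : ℕ}

lemma card_le_dim_add_ncard (σ : VETuple k n) : dim σ + (suppV σ).ncard ≤ n := by
  have h1 : (suppV σ).ncard ≤ (Finset.univ.filter fun i => ¬ (σ i).isRight = true).card := by
    rw [← Set.ncard_image_of_injective (suppV σ) (Sum.inl_injective (β := ZMod k))]
    refine le_trans (Set.ncard_le_ncard ?_ (Finset.finite_toSet _))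
      ((Set.ncard_coe_finset _).le.trans (Finset.card_image_le (f := σ)))
    rintro _ ⟨j, ⟨i, hi⟩, rfl⟩
    simp only [Finset.coe_image, Set.mem_image, Finset.coe_filter, Finset.mem_univ, true_and,
      Set.mem_ofPred_eq]
    exact ⟨i, by simp [hi], hi⟩
  have h2 := Finset.card_filter_add_card_filter_not (s := (Finset.univ : Finset (Fin n)))
    (fun i => (σ i).isRight = true)
  rw [Finset.card_univ, Fintype.card_fin] at h2
  unfold dim
  omega

lemma subsingleton_homology_complexPq {q : ℕ} {i : ℤ} (hi : i < 0 ∨ (n : ℤ) - (q : ℤ) < i) :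
    Subsingleton ((complexPq k n Set.univ q).homology i) := by
  have : IsEmpty (Gen (genSet k n Set.univ q) i) := by
    refine ⟨fun ⟨σ, hσ, hd⟩ => ?_⟩
    have h1 := hσ.2
    have h2 := card_le_dim_add_ncard σ
    omega
  have hX : Subsingleton ((complexPq k n Set.univ q).sc i).X₂ :=
    inferInstanceAs (Subsingleton (Gen (genSet k n Set.univ q) i →₀ ℤ))
  have h0 : Limits.IsZero ((complexPq k n Set.univ q).sc i).homology :=
    ShortComplex.isZero_homology_of_isZero_X₂ _ (ModuleCat.isZero_of_subsingleton _)
  exact ModuleCat.subsingleton_of_isZero h0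

/-! ### Chains of the subcomplex as functions on all tuples -/

/-- Extension by zero of a chain to a function on all tuples. -/
def extendGen (S : Set (VETuple k n)) (d : ℤ) : (Gen S d →₀ ℤ) →ₗ[ℤ] (VETuple k n → ℤ) :=
  Finsupp.lcoeFun ∘ₗ Finsupp.lmapDomain ℤ ℤ (Subtype.val : Gen S d → VETuple k n)

lemma extendGen_val {S : Set (VETuple k n)} {d : ℤ} (x : Gen S d →₀ ℤ) (σ : Gen S d) :
    extendGen S d x σ.1 = x σ :=
  Finsupp.mapDomain_apply Subtype.val_injective x σ

lemma extendGen_of_not_mem {S : Set (VETuple k n)} {d : ℤ} (x : Gen S d →₀ ℤ) {σ : VETuple k n}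
    (h : ¬ (σ ∈ S ∧ (dim σ : ℤ) = d)) : extendGen S d x σ = 0 := by
  refine Finsupp.mapDomain_of_notMem_range x σ ?_
  rintro ⟨τ, rfl⟩
  exact h τ.2

lemma extendGen_injective (S : Set (VETuple k n)) (d : ℤ) :
    Function.Injective (extendGen S d) := by
  intro x y h
  ext σ
  rw [← extendGen_val, ← extendGen_val, h]

variable [NeZero k]

lemma exists_extendGen_eq {S : Set (VETuple k n)} {d : ℤ} {x : VETuple k n → ℤ}
    (hx : ∀ σ, x σ ≠ 0 → σ ∈ S ∧ (dim σ : ℤ) = d) : ∃ y, extendGen S d y = x := by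
  refine ⟨projGen S d (Finsupp.equivFunOnFinite.symm x), ?_⟩
  ext σ
  by_cases h : σ ∈ S ∧ (dim σ : ℤ) = d
  · exact extendGen_val _ ⟨σ, h⟩
  · rw [extendGen_of_not_mem _ h, not_not.mp (mt (hx σ) h)]

lemma exists_of_bdFun_ne_zero {x : VETuple k n → ℤ} {τ : VETuple k n}
    (h : bdFun k n x τ ≠ 0) : ∃ σ, x σ ≠ 0 ∧ dim σ = dim τ + 1 ∧ vsupp σ ⊆ vsupp τ := by
  by_contra! hc
  apply h
  rw [bdFun_apply]
  refine Finset.sum_eq_zero fun i _ => ?_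
  rcases hi : τ i with a | a
  · have h0 (b : ZMod k) : x (Function.update τ i (Sum.inr b)) = 0 := by
      by_contra h0
      exact hc _ h0 (dim_update_inr hi b) (vsupp_update_inr_subset τ i b)
    rw [signedOp_bdMat_inl hi, h0, h0, sub_self, mul_zero]
  · exact signedOp_bdMat_inr hi

lemma mem_genSet_univ {q : ℕ} {σ : VETuple k n} :
    σ ∈ genSet k n Set.univ q ↔ q ≤ (vsupp σ).card := by
  simp [genSet, ncard_suppV]

/-- Passing to a face can only enlarge the vertex support, so no face of a generator is discarded.
-/
lemma extendGen_bdRes {q : ℕ} {d e : ℤ} (hde : e + 1 = d)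
    (x : Gen (genSet k n Set.univ q) d →₀ ℤ) :
    extendGen _ e (bdRes (genSet k n Set.univ q) d e x) = bdFun k n (extendGen _ d x) := by
  ext τ
  by_cases h : τ ∈ genSet k n Set.univ q ∧ (dim τ : ℤ) = e
  · refine (extendGen_val _ ⟨τ, h⟩).trans ?_
    exact congrFun (bd_apply _) τ
  · rw [extendGen_of_not_mem _ h]
    by_contra h0
    obtain ⟨σ, hσ, h1, h2⟩ := exists_of_bdFun_ne_zero (Ne.symm h0)
    obtain ⟨h3, h4⟩ := not_not.mp (mt (extendGen_of_not_mem x) hσ)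
    rw [mem_genSet_univ] at h3 h
    exact h ⟨h3.trans (Finset.card_le_card h2), by omega⟩

/-! ### Homology below degree `n - q` through periods -/

lemma extendGen_support_iff {q d : ℕ} {x : VETuple k n → ℤ} :
    (∀ σ, x σ ≠ 0 → σ ∈ genSet k n Set.univ q ∧ (dim σ : ℤ) = d) ↔
      IsHom d x ∧ VanishOn (smallSets k q) x := by
  refine ⟨fun h => ⟨fun σ hσ => by exact_mod_cast (h σ hσ).2, fun σ hσ => ?_⟩,
    fun h σ hσ => ⟨?_, by exact_mod_cast h.1 σ hσ⟩⟩
  · by_contra h0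
    have := mem_genSet_univ.mp (h σ h0).1
    rw [mem_smallSets] at hσ
    omega
  · rw [mem_genSet_univ]
    by_contra h0
    exact hσ (h.2 σ (mem_smallSets.mpr (not_le.mp h0)))

lemma nonempty_homology_complexPq {q i : ℕ} (hq : q ≤ k) (hi : i + q < n) :
    Nonempty ((complexPq k n Set.univ q).homology (i : ℤ) ≃ₗ[ℤ] (Fin (n.choose i) → ℤ)) := by
  set S := genSet k n Set.univ q with hS
  set K := complexPq k n Set.univ q with hK
  have hcard : Fintype.card {I : Finset (Fin n) // I.card = i} = Fintype.card (Fin (n.choose i)) := by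
    rw [Fintype.card_finset_len, Fintype.card_fin, Fintype.card_fin]
  let Φ : (Gen S (i : ℤ) →₀ ℤ) →ₗ[ℤ] ({I : Finset (Fin n) // I.card = i} → ℤ) :=
    (LinearMap.pi fun I => period k I.1) ∘ₗ extendGen S i
  have hsupp (d : ℕ) (x : Gen S (d : ℤ) →₀ ℤ) :
      IsHom d (extendGen S d x) ∧ VanishOn (smallSets k q) (extendGen S d x) :=
    extendGen_support_iff.mp fun σ hσ => not_not.mp (mt (extendGen_of_not_mem x) hσ)
  have hcycle (x : Gen S (i : ℤ) →₀ ℤ) :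
      bdRes S (i : ℤ) ((i : ℤ) - 1) x = 0 ↔ bdFun k n (extendGen S i x) = 0 := by
    rw [← extendGen_bdRes (e := (i : ℤ) - 1) (sub_add_cancel _ _), map_eq_zero_iff _ (extendGen_injective _ _)]
  -- The periods over the `i`-element sets serve as `Φ`. Integer degrees allow `i = 0`, where the
  -- target of the boundary is the zero group in degree `-1`.
  obtain ⟨e⟩ := nonempty_homology_linearEquiv (K.sc' ((i + 1 : ℕ) : ℤ) (i : ℤ) ((i : ℤ) - 1)) Φ
    (fun c => by
      obtain ⟨x, hx, hv, hb, hp⟩ := exists_vanishOn_cycle_with_periods (k := k) hq hi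
        (fun I => if h : I.card = i then c ⟨I, h⟩ else 0)
      obtain ⟨y, rfl⟩ := exists_extendGen_eq (extendGen_support_iff.mpr ⟨hx, hv⟩)
      refine ⟨y, (hcycle y).mpr hb, funext fun I => (hp I.1 I.2).trans ?_⟩
      simp [I.2])
    (fun x hx => by
      have hb : bdFun k n (extendGen S i x) = 0 := (hcycle x).mp hx
      have hbd (y : Gen S ((i + 1 : ℕ) : ℤ) →₀ ℤ) :
          extendGen S i (bdRes S ((i + 1 : ℕ) : ℤ) i y) = bdFun k n (extendGen S _ y) :=
        extendGen_bdRes (by push_cast; rfl) y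
      constructor
      · intro h
        obtain ⟨y, hy, hv, hyx⟩ := exists_bdFun_eq_of_vanishOn hq hi (hsupp i x).1 (hsupp i x).2 hb
          (fun I hI => congrFun h ⟨I, hI⟩)
        obtain ⟨z, rfl⟩ := exists_extendGen_eq (extendGen_support_iff.mpr ⟨hy, hv⟩)
        exact ⟨z, extendGen_injective S i ((hbd z).trans hyx)⟩
      · rintro ⟨y, rfl⟩
        funext I
        exact (congrArg (period k I.1) (hbd y)).trans (period_bdFun _ _))
  exact ⟨(K.homologyIsoSc' ((i + 1 : ℕ) : ℤ) (i : ℤ) ((i : ℤ) - 1)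
    ((ChainComplex.prev ℤ (i : ℤ)).trans (by push_cast; rfl))
    (ChainComplex.next ℤ (i : ℤ))).toLinearEquiv ≪≫ₗ e ≪≫ₗ
    LinearEquiv.funCongrLeft ℤ ℤ (Fintype.equivOfCardEq hcard).symm⟩

end

end AnchoredConf

end

theorem theorem4p4 (k n q : ℕ) (hk : 2 ≤ k) (hkn : k ≤ n) (hq : q ≤ k) :
    -- `Ω(k,n,q)` is a union of closed cells, and its cubical chain complex is `C^{ℤ_k,q}`
    (AnchoredConf.Omega k n q
        = ⋃ σ ∈ AnchoredConf.cellsIn (AnchoredConf.Omega k n q), AnchoredConf.closedCell σ) ∧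
    Nonempty (AnchoredConf.complexPq k n Set.univ q ≅
      AnchoredConf.cubicalComplex (AnchoredConf.Omega k n q)) ∧
    -- the homology in degrees `0 ≤ i ≤ n - q - 1`
    (∀ i : ℕ, (i : ℤ) ≤ (n : ℤ) - (q : ℤ) - 1 →
      Nonempty ((AnchoredConf.complexPq k n Set.univ q).homology (i : ℤ) ≃ₗ[ℤ]
        (Fin (n.choose i) → ℤ))) ∧
    -- the homology in degrees `i < 0` and `i > n - q`
    (∀ i : ℤ, i < 0 ∨ (n : ℤ) - (q : ℤ) < i →
      Subsingleton ((AnchoredConf.complexPq k n Set.univ q).homology i)) := by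
  have : NeZero k := ⟨by omega⟩
  exact ⟨AnchoredConf.Omega_eq_iUnion k n q, AnchoredConf.nonempty_iso_cubicalComplex k n q,
    fun i hi => AnchoredConf.nonempty_homology_complexPq hq (by omega),
    fun i hi => AnchoredConf.subsingleton_homology_complexPq hi⟩
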